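/- **Setting.** Let $(X_p,Z_p)_{p\ge 1}$ be i.i.d. with values in $\mathbb R^k\times\mathbb R$. $X$ has density $f_X$, and the conditional law of $Z$ given $X=x$ is $\lambda F_1(\cdot-m_1(x))+(1-\lambda)F_2(\cdot-m_2(x))$, where $\lambda\in(0,1)$ and $F_1,F_2$ are probability laws on $\mathbb R$, not depending on $x$, with mean zero and finite second moment. Write $M_l(t)=\int e^{te}\,dF_l(e)$ and $\phi_l(s)=\int e^{ise}\,dF_l(e)$. Fix $x_0,x_1\in\mathbb R^k$, put $\Delta=m_1(x_1)-m_1(x_0)$ and $\nabla=m_2(x_1)-m_2(x_0)$, and assume $\Delta\ne\nabla$. **Estimators.** For a kernel $K$ and a bandwidth $h>0$, the Nadaraya–Watson estimator at $x$ from $(X_p,Y_p)_{p\le n}$ is $\sum_{p\le n} Y_pK(\tfrac{X_p-x}{h})\big/\sum_{p\le n}K(\tfrac{X_p-x}{h})$. Let $\hat M^j(t)$ be this estimator at $x_j$ for $Y_p=e^{tZ_p}$ and bandwidth $h_n$, and $\hat\phi^j(s)$ the one for $Y_p=e^{isZ_p}$ and bandwidth $b_n$, both with kernel $K$. Let $\hat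 E(Z^r|X=x)$ be the estimator for $Y_p=Z_p^r$, bandwidth $d_n$ and a possibly different kernel $L$. With tuning sequences $t_n,s_n,a_n$ and the principal logarithm $\mathrm{Log}$, put $$\hat\Delta=\frac1{t_n}\log\frac{\hat M^1(t_n)}{\hat M^0(t_n)},\qquad \hat\nabla=\frac{-i}{a_n}\mathrm{Log}\left(\frac{\hat\phi^1(s_n+a_n)}{\hat\phi^0(s_n+a_n)}\Big(\frac{\hat\phi^1(s_n)}{\hat\phi^0(s_n)}\Big)^{-1}\right),$$ $$\hat\lambda=\frac{\hat E(Z|X=x_1)-\hat E(Z|X=x_0)-\hat\nabla}{\hat\Delta-\hat\nabla},$$ $$\hat C=\tfrac12\left(\hat E(Z^2|X=x_0)-\hat E(Z^2|X=x_1)+\hat\lambda\hat\Delta^2+(1-\hat\lambda)\hat\nabla^2\right),$$ $$\begin{pmatrix}\hat m_1(x_0)\\ \hat m_2(x_0)\end{pmatrix}=\begin{pmatrix}\hat\lambda^{-1}&0\\0&(1-\hat\lambda)^{-1}\end{pmatrix}\begin{pmatrix}-\hat\Delta&-\hat\nabla\\1&1\end{pmatrix}^{-1}\begin{pmatrix}\hat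 C\\ \hat E(Z|X=x_0)\end{pmatrix}.$$ ($\hat\nabla$, hence also $\hat\lambda$ and $\hat m_i(x_0)$, may be complex; errors are measured in modulus.) **Assumptions.** 1. Each of the kernels $K,L:\mathbb R^k\to\mathbb R$ satisfies (written for $K$): $\int|K|<\infty$, $\int K=1$, $uK(u)\to0$ as $\|u\|\to\infty$, $\int K^2<\infty$, $\int|K(u)|\|u\|^2du<\infty$, $\int K(u)u\,du=0$, and there is $\alpha_0>0$ such that $\int e^{\alpha\|u\|}|K(u)|\|u\|^2du<\infty$ and $\int e^{\alpha\|u\|}K(u)^2du<\infty$ for all $\alpha\le\alpha_0$. 2. $f_X,m_1,m_2$ are $C^2$ on $\mathbb R^k$ with bounded first and second order partial derivatives, $f_X$ is bounded, $f_X(x_0)>0$ and $f_X(x_1)>0$. 3. $h_n,b_n,d_n>0$; $h_n,b_n\to0$; $nh_n^k,nb_n^k\to\infty$; $d_n$ is of exact order $n^{-1/(k+4)}$; $t_n,s_n\to\infty$; $t_nh_n\to0$; $s_nb_n\to0$; $a_n\ne0$ and $a_n\to0$. 4. $M_1(t),M_2(t)<\infty$ for all $t\ge0$. There is $\mu\ge0$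 with $\mu(t)\to0$ as $t\to\infty$ and, for every $\eta>0$, $e^{\eta t}M_2(t)/M_1(t)=O(\mu(t))$ as $t\to\infty$. Moreover $\phi_2(s)\ne0$ for all large $s$, and there is $f\ge0$ with $f(s)\to0$ and $\phi_1(s)/\phi_2(s)=O(f(s))$ as $s\to\infty$. Define $$\alpha_n=\frac{\mu(t_n)}{t_n}+\frac1{t_n}\left((t_nh_n)^4+\frac1{nh_n^k}\frac{M_1(2t_n)}{M_1(t_n)^2}\right)^{1/2},$$ $$\beta_n=\frac1{|a_n|}\left[f(s_n+a_n)+f(s_n)+\Big((b_ns_n)^4+\frac1{nb_n^k|\phi_2(s_n+a_n)|^2}\Big)^{1/2}+\Big((b_ns_n)^4+\frac1{nb_n^k|\phi_2(s_n)|^2}\Big)^{1/2}\right],$$ and $\epsilon_n=n^{-2/(k+4)}+\alpha_n+\beta_n$. Assume finally that $\frac1{nh_n^k}\frac{M_1(2t_n)}{M_1(t_n)^2}\to0$ and $\beta_n\to0$. **Conclusion.** 1. $\hat\lambda-\lambda=O_{\mathbb P}(\epsilon_n)$. 2. If moreover $F_1$ and $F_2$ have finite fourth moments, then $\hat m_i(x_0)-m_i(x_0)=O_{\mathbb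 P}(\epsilon_n)$ for $i=1,2$. -/

import Mathlib

open MeasureTheory ProbabilityTheory Filter Topology Asymptotics Matrix

noncomputable section

namespace MixRate

/-- The covariate space `ℝ^k` with its Euclidean norm. -/
abbrev Cov (k : ℕ) := EuclideanSpace ℝ (Fin k)

/-- `Y n = O_P(r n)` for random quantities `Y n` and a nonnegative deterministic rate `r`. -/
def IsBigOP {Ω : Type*} [MeasurableSpace Ω] (P : Measure Ω) (Y : ℕ → Ω → ℂ) (r : ℕ → ℝ) : Prop :=
  ∀ η : ℝ, 0 < η → ∃ C : ℝ, ∀ᶠ n in atTop, P {ω | C * r n < ‖Y n ω‖} ≤ ENNReal.ofReal η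

/-- The conditions on a (second order, possibly signed) kernel function on `ℝ^k`. -/
structure IsKernel {k : ℕ} (K : Cov k → ℝ) : Prop where
  integrable : Integrable K
  integral_eq_one : ∫ u, K u = 1
  decay : Tendsto (fun u => K u • u) (cocompact (Cov k)) (𝓝 0)
  integrable_sq : Integrable (fun u => K u ^ 2)
  integrable_norm_sq : Integrable (fun u => |K u| * ‖u‖ ^ 2)
  first_moment : ∫ u, K u • u = 0
  exp_moment : ∃ α₀ : ℝ, 0 < α₀ ∧ ∀ α ≤ α₀,
    Integrable (fun u => Real.exp (α * ‖u‖) * |K u| * ‖u‖ ^ 2) ∧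
    Integrable (fun u => Real.exp (α * ‖u‖) * K u ^ 2)

/-- All partial derivatives of `g` of orders `1` and `2` are bounded on `ℝ^k`. -/
def BoundedDerivs {k : ℕ} (g : Cov k → ℝ) : Prop :=
  ∃ C : ℝ, ∀ x, ‖iteratedFDeriv ℝ 1 g x‖ ≤ C ∧ ‖iteratedFDeriv ℝ 2 g x‖ ≤ C

/-- The law `lam * F₁(· - c₁) + (1 - lam) * F₂(· - c₂)` on the real line. -/
def shiftMixture (lam : ℝ) (F₁ F₂ : Measure ℝ) (c₁ c₂ : ℝ) : Measure ℝ :=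
  ENNReal.ofReal lam • F₁.map (fun e => c₁ + e) +
    ENNReal.ofReal (1 - lam) • F₂.map (fun e => c₂ + e)

/-- `(X p, Z p)`, `p = 0, 1, 2, …`, is an i.i.d. sample from the two-component switching regression
model: `X` has density `fX`, and given `X = x`, `Z` is `m₁ x + ε₁` with probability `lam` and
`m₂ x + ε₂` with probability `1 - lam`, where `ε₁ ∼ F₁` and `ε₂ ∼ F₂` whatever the value of `x`. -/
structure IsMixtureSample {Ω : Type*} [MeasurableSpace Ω] (P : Measure Ω) [IsFiniteMeasure P]
    {k : ℕ} (X : ℕ → Ω → Cov k) (Z : ℕ → Ω → ℝ) (fX : Cov k → ℝ) (lam : ℝ) (F₁ F₂ : Measure ℝ)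
    (m₁ m₂ : Cov k → ℝ) : Prop where
  measurable_X : ∀ p, Measurable (X p)
  measurable_Z : ∀ p, Measurable (Z p)
  indep : iIndepFun (fun p ω => (X p ω, Z p ω)) P
  ident : ∀ p, IdentDistrib (fun ω => (X p ω, Z p ω)) (fun ω => (X 0 ω, Z 0 ω)) P P
  density_nonneg : ∀ x, 0 ≤ fX x
  density : P.map (X 0) = volume.withDensity (fun x => ENNReal.ofReal (fX x))
  cond_law : ∀ᵐ x ∂(P.map (X 0)),
    condDistrib (Z 0) (X 0) P x = shiftMixture lam F₁ F₂ (m₁ x) (m₂ x)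

/-- The bandwidths `h, b, d` and the tuning parameters `t, s, a`, indexed by the sample size. -/
structure Tuning where
  h : ℕ → ℝ
  b : ℕ → ℝ
  d : ℕ → ℝ
  t : ℕ → ℝ
  s : ℕ → ℝ
  a : ℕ → ℝ

/-- The Nadaraya–Watson regression estimator at `x`, of bandwidth `h`, from the first `n` pairs
`(X p, Y p)`. -/
def nadarayaWatson {𝕜 : Type*} [RCLike 𝕜] {k : ℕ} (K : Cov k → ℝ) (n : ℕ) (h : ℝ)
    (X : ℕ → Cov k) (Y : ℕ → 𝕜) (x : Cov k) : 𝕜 :=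
  (∑ p ∈ Finset.range n, Y p * (K (h⁻¹ • (X p - x)) : 𝕜)) /
    ∑ p ∈ Finset.range n, (K (h⁻¹ • (X p - x)) : 𝕜)

section Estimators

variable {k : ℕ} (K : Cov k → ℝ) (T : Tuning) (x₀ x₁ : Cov k) (n : ℕ)
  (X : ℕ → Cov k) (Z : ℕ → ℝ)

/-- Estimator of the conditional moment generating function of `Z` given `X = x`, at `t`. -/
def hatMgf (x : Cov k) (t : ℝ) : ℝ :=
  nadarayaWatson K n (T.h n) X (fun p => Real.exp (t * Z p)) x

/-- Estimator of the conditional characteristic function of `Z` given `X = x`, at `s`. -/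
def hatCf (x : Cov k) (s : ℝ) : ℂ :=
  nadarayaWatson K n (T.b n) X (fun p => Complex.exp (Complex.I * s * Z p)) x

/-- The estimator `Δ̂` of `m₁ x₁ - m₁ x₀`. -/
def hatDelta : ℝ :=
  1 / T.t n * Real.log (hatMgf K T n X Z x₁ (T.t n) / hatMgf K T n X Z x₀ (T.t n))

/-- The (complex valued) estimator `∇̂` of `m₂ x₁ - m₂ x₀`; `Complex.log` is the principal value. -/
def hatNabla : ℂ :=
  -Complex.I / (T.a n : ℂ) * Complex.log
    (hatCf K T n X Z x₁ (T.s n + T.a n) / hatCf K T n X Z x₀ (T.s n + T.a n) *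
      (hatCf K T n X Z x₁ (T.s n) / hatCf K T n X Z x₀ (T.s n))⁻¹)

variable (L : Cov k → ℝ)

/-- Kernel estimator (with kernel `L`) of the conditional moment `E(Z ^ j | X = x)`. -/
def hatMoment (j : ℕ) (x : Cov k) : ℝ :=
  nadarayaWatson L n (T.d n) X (fun p => Z p ^ j) x

/-- The plug-in estimator of the mixing weight. -/
def hatLambda : ℂ :=
  ((hatMoment T n X Z L 1 x₁ : ℂ) - (hatMoment T n X Z L 1 x₀ : ℂ) - hatNabla K T x₀ x₁ n X Z) /
    ((hatDelta K T x₀ x₁ n X Z : ℂ) - hatNabla K T x₀ x₁ n X Z)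

/-- The auxiliary estimator `Ĉ`. -/
def hatC : ℂ :=
  1 / 2 * ((hatMoment T n X Z L 2 x₀ : ℂ) - (hatMoment T n X Z L 2 x₁ : ℂ)
    + hatLambda K T x₀ x₁ n X Z L * (hatDelta K T x₀ x₁ n X Z : ℂ) ^ 2
    + (1 - hatLambda K T x₀ x₁ n X Z L) * hatNabla K T x₀ x₁ n X Z ^ 2)

/-- The plug-in estimators of `m₁ x₀` (entry `0`) and `m₂ x₀` (entry `1`). -/
def hatM : Fin 2 → ℂ :=
  (!![(hatLambda K T x₀ x₁ n X Z L)⁻¹, 0;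
      0, (1 - hatLambda K T x₀ x₁ n X Z L)⁻¹] *
    (!![-(hatDelta K T x₀ x₁ n X Z : ℂ), -hatNabla K T x₀ x₁ n X Z;
        1, 1])⁻¹) *ᵥ ![hatC K T x₀ x₁ n X Z L, (hatMoment T n X Z L 1 x₀ : ℂ)]

end Estimators

/-- The variance term `M₁(2 t_n) / (n h_n^k M₁(t_n)^2)`. -/
def mgfVariance (k : ℕ) (T : Tuning) (F₁ : Measure ℝ) (n : ℕ) : ℝ :=
  1 / (n * T.h n ^ k) * (mgf id F₁ (2 * T.t n) / mgf id F₁ (T.t n) ^ 2)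

/-- The rate `α_n` of `Δ̂`. -/
def alphaRate (k : ℕ) (T : Tuning) (F₁ : Measure ℝ) (μ : ℝ → ℝ) (n : ℕ) : ℝ :=
  μ (T.t n) / T.t n + 1 / T.t n * √((T.t n * T.h n) ^ 4 + mgfVariance k T F₁ n)

/-- The term `((b_n s_n)^4 + 1 / (n b_n^k |φ₂(s)|^2))^(1/2)`. -/
def cfError (k : ℕ) (T : Tuning) (F₂ : Measure ℝ) (n : ℕ) (s : ℝ) : ℝ :=
  √((T.b n * T.s n) ^ 4 + 1 / (n * T.b n ^ k * ‖charFun F₂ s‖ ^ 2))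

/-- The rate `β_n` of `∇̂`. -/
def betaRate (k : ℕ) (T : Tuning) (F₂ : Measure ℝ) (f : ℝ → ℝ) (n : ℕ) : ℝ :=
  1 / |T.a n| * (f (T.s n + T.a n) + f (T.s n)
    + cfError k T F₂ n (T.s n + T.a n) + cfError k T F₂ n (T.s n))

/-- The rate `ε_n = n^(-2/(k+4)) + α_n + β_n`. -/
def epsRate (k : ℕ) (T : Tuning) (F₁ F₂ : Measure ℝ) (μ f : ℝ → ℝ) (n : ℕ) : ℝ :=
  (n : ℝ) ^ (-(2 : ℝ) / (k + 4)) + alphaRate k T F₁ μ n + betaRate k T F₂ f n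

end MixRate

end

/-! Given `X = x`, the moment generating function of `Z` at `t` is `λ e^{t m₁(x)} M₁(t) + (1-λ) e^{t
m₂(x)} M₂(t)`. Since `M₂/M₁` decays faster than every exponential, the first component dominates for
large `t`, wherever `m₁(x)` and `m₂(x)` lie. The ratio between `x₁` and `x₀` is then close to
`e^{tΔ}`, and `log/t` recovers `Δ`. For the characteristic function the second component dominates,
because `φ₁/φ₂ → 0`. There the ratio is close to `e^{is∇}`, which fixes `s∇` only modulo `2π`.
Comparing `s_n` with `s_n + a_n` leaves the phase `a_n ∇ → 0`, which the principal logarithm reads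
off without ambiguity, at the price of a factor `1/|a_n|` in the error.

With the slopes known, `E(Z|x₁) - E(Z|x₀) = λΔ + (1-λ)∇` gives `λ`. In the difference of second
moments the error variances cancel, and what remains is a linear equation for `m₁(x₀), m₂(x₀)`.
Together with `E(Z|x₀)` it forms a system of determinant `∇ - Δ ≠ 0`. The plug-in formulas are
smooth at the limits, so the rate passes through them by the delta method (`EstimatesAt`).

All kernel estimators are handled by one result, `IsMixtureSample.nadarayaWatson_rate`. Weights are
divided by the dominant term at `x`, so that the target does not depend on `n`. The error then has
three sources: the negligible component (`δ`), the smoothing bias `(ρ h)²` of a function varying at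
scale `1/ρ`, and a Chebyshev variance `V/(n h^k)`. Functions such as `e^{t m}` grow exponentially at
the scale `1/t`. `QuadApprox` allows for this growth, and the exponential moments of the kernel
absorb it as soon as `ρ h` is small. The instances are `hatCf_rate`, `hatMgf_rate` and
`hatMoment_rate`, and the slopes follow in `hatDelta_rate` and `hatNabla_rate`. -/

noncomputable section

namespace MixRate

/-! ### Calculus of stochastic orders. -/

section StochasticOrder

variable {Ω : Type*} [MeasurableSpace Ω] {P : Measure Ω}

/-- `Y n = O_P(r n)` for real random quantities that are bounded from above in probability. -/
def StochBdd (P : Measure Ω) (Y : ℕ → Ω → ℝ) (r : ℕ → ℝ) : Prop :=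
  ∀ η : ℝ, 0 < η → ∃ C : ℝ, ∀ᶠ n in atTop, P {ω | C * r n < Y n ω} ≤ ENNReal.ofReal η

theorem StochBdd.mono_rate {Y : ℕ → Ω → ℝ} {r r' : ℕ → ℝ} (h : StochBdd P Y r) {c : ℝ}
    (hr : ∀ᶠ n in atTop, 0 ≤ r n) (hrr' : ∀ᶠ n in atTop, r n ≤ c * r' n) : StochBdd P Y r' := by
  intro η hη
  obtain ⟨C, hC⟩ := h η hη
  -- The constant supplied by the hypothesis may be negative, hence the absolute value.
  refine ⟨|C| * c, ?_⟩
  filter_upwards [hC, hr, hrr'] with n h1 h2 h3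
  refine (measure_mono fun ω hω => ?_).trans h1
  simp only [Set.mem_ofPred_eq] at hω ⊢
  have h4 : C * r n ≤ |C| * r n := mul_le_mul_of_nonneg_right (le_abs_self C) h2
  have h5 : |C| * r n ≤ |C| * (c * r' n) := mul_le_mul_of_nonneg_left h3 (abs_nonneg C)
  linarith

theorem StochBdd.add {Y Y' : ℕ → Ω → ℝ} {r : ℕ → ℝ} (h : StochBdd P Y r) (h' : StochBdd P Y' r) :
    StochBdd P (fun n ω => Y n ω + Y' n ω) r := by
  intro η hη
  obtain ⟨C, hC⟩ := h (η / 2) (half_pos hη)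
  obtain ⟨C', hC'⟩ := h' (η / 2) (half_pos hη)
  refine ⟨C + C', ?_⟩
  filter_upwards [hC, hC'] with n h1 h2
  have hsub : {ω | (C + C') * r n < Y n ω + Y' n ω} ⊆
      {ω | C * r n < Y n ω} ∪ {ω | C' * r n < Y' n ω} := by
    intro ω hω
    simp only [Set.mem_union, Set.mem_ofPred_eq] at hω ⊢
    by_contra! hcon
    linarith [hcon.1, hcon.2]
  calc P {ω | (C + C') * r n < Y n ω + Y' n ω}
      ≤ P {ω | C * r n < Y n ω} + P {ω | C' * r n < Y' n ω} :=
        (measure_mono hsub).trans (measure_union_le _ _)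
    _ ≤ ENNReal.ofReal (η / 2) + ENNReal.ofReal (η / 2) := add_le_add h1 h2
    _ = ENNReal.ofReal η := by
        rw [← ENNReal.ofReal_add (by positivity) (by positivity), add_halves]

theorem StochBdd.congr_ae {Y Y' : ℕ → Ω → ℝ} {r : ℕ → ℝ} (h : StochBdd P Y r)
    (hY : ∀ n, ∀ᵐ ω ∂P, Y' n ω ≤ Y n ω) : StochBdd P Y' r := by
  intro η hη
  obtain ⟨C, hC⟩ := h η hη
  refine ⟨C, ?_⟩
  filter_upwards [hC] with n h1
  refine (measure_mono_ae ?_).trans h1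
  filter_upwards [hY n] with ω hω hlt
  exact lt_of_lt_of_le hlt hω

/-- A bound that holds where `Y` is small transfers a vanishing stochastic order. -/
theorem StochBdd.transfer {Y W : ℕ → Ω → ℝ} {r ρ : ℕ → ℝ} (h : StochBdd P Y r)
    (hr : Tendsto r atTop (𝓝 0)) {δ C : ℝ} (hδ : 0 < δ) (hC : 0 ≤ C) (hρ : ∀ᶠ n in atTop, 0 ≤ ρ n)
    (hW : ∀ᶠ n in atTop, ∀ ω, Y n ω ≤ δ → W n ω ≤ C * (ρ n * Y n ω)) :
    StochBdd P W (fun n => ρ n * r n) := by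
  intro η hη
  obtain ⟨D, hD⟩ := h η hη
  refine ⟨C * D, ?_⟩
  -- As `D * r n → 0`, the event `Y n ≤ D * r n` is eventually inside `Y n ≤ δ`, where the
  -- deterministic bound is available.
  have hsmall : ∀ᶠ n in atTop, D * r n < δ := by
    have : Tendsto (fun n => D * r n) atTop (𝓝 0) := by simpa using hr.const_mul D
    exact this.eventually_lt_const hδ
  filter_upwards [hD, hρ, hW, hsmall] with n h1 h2 h3 h4
  refine (measure_mono fun ω hω => ?_).trans h1
  simp only [Set.mem_ofPred_eq] at hω ⊢
  by_contra! hcon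
  have h5 := h3 ω (hcon.trans h4.le)
  have h6 : C * (ρ n * Y n ω) ≤ C * (ρ n * (D * r n)) := by gcongr
  nlinarith

theorem StochBdd.transfer' {Y W : ℕ → Ω → ℝ} {r : ℕ → ℝ} (h : StochBdd P Y r)
    (hr : Tendsto r atTop (𝓝 0)) {δ C : ℝ} (hδ : 0 < δ) (hC : 0 ≤ C)
    (hW : ∀ᶠ n in atTop, ∀ ω, Y n ω ≤ δ → W n ω ≤ C * Y n ω) : StochBdd P W r := by
  have := h.transfer (W := W) (ρ := fun _ => 1) hr hδ hC (by simp)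
    (by filter_upwards [hW] with n hn ω hω; simpa using hn ω hω)
  simpa using this

theorem StochBdd.of_le {Y W : ℕ → Ω → ℝ} {r : ℕ → ℝ} (h : StochBdd P Y r)
    (hW : ∀ n ω, W n ω ≤ Y n ω) : StochBdd P W r :=
  h.congr_ae fun n => ae_of_all _ (hW n)

/-- The delta method for stochastic orders. -/
theorem StochBdd.comp_differentiableAt {E F : Type*} [NormedAddCommGroup E] [NormedSpace ℂ E]
    [NormedAddCommGroup F] [NormedSpace ℂ F] {Y : ℕ → Ω → E} {y : E} {r : ℕ → ℝ} {g : E → F}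
    (h : StochBdd P (fun n ω => ‖Y n ω - y‖) r) (hr : Tendsto r atTop (𝓝 0))
    (hg : DifferentiableAt ℂ g y) : StochBdd P (fun n ω => ‖g (Y n ω) - g y‖) r := by
  -- Differentiability serves only to give a linear bound for `g - g y` on a small ball around `y`.
  obtain ⟨C, hC, hCO⟩ := hg.isBigO_sub.exists_pos
  obtain ⟨ε, hε, hball⟩ := Metric.eventually_nhds_iff.1 hCO.bound
  refine h.transfer' hr (half_pos hε) hC.le (Eventually.of_forall fun n ω hω => ?_)
  exact hball (by rw [dist_eq_norm]; linarith)

end StochasticOrder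

/-! ### Second order approximation at scale `1/ρ`. -/

section QuadraticApproximation

variable {k : ℕ}

/-- `G` agrees at `x` to second order with an affine function, at the scale `1 / ρ` and up to an
exponentially growing factor. -/
structure QuadApprox (G : Cov k → ℂ) (x : Cov k) (ρ C c : ℝ) : Prop where
  continuous : Continuous G
  lip : ∀ v, ‖G (x + v) - G x‖ ≤ C * (ρ * ‖v‖) * Real.exp (c * (ρ * ‖v‖))
  quad : ∃ ℓ : Cov k →L[ℝ] ℂ, ∀ v,
    ‖G (x + v) - G x - ℓ v‖ ≤ C * (ρ * ‖v‖) ^ 2 * Real.exp (c * (ρ * ‖v‖))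

theorem QuadApprox.const (a : ℂ) (x : Cov k) {ρ C : ℝ} (c : ℝ) (hρ : 0 ≤ ρ) (hC : 0 ≤ C) :
    QuadApprox (fun _ => a) x ρ C c where
  continuous := continuous_const
  lip v := by simpa using by positivity
  quad := ⟨0, fun v => by simpa using by positivity⟩

theorem QuadApprox.mono {G : Cov k → ℂ} {x : Cov k} {ρ C c ρ' C' c' : ℝ}
    (h : QuadApprox G x ρ C c) (hρ : 0 ≤ ρ) (hρ' : ρ ≤ ρ') (hC : 0 ≤ C) (hC' : C ≤ C') (hc : 0 ≤ c)
    (hc' : c ≤ c') : QuadApprox G x ρ' C' c' where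
  continuous := h.continuous
  lip v := by
    have := hρ.trans hρ'; have := hC.trans hC'; have := hc.trans hc'
    exact (h.lip v).trans (by gcongr)
  quad := by
    have := hρ.trans hρ'; have := hC.trans hC'; have := hc.trans hc'
    obtain ⟨ℓ, hℓ⟩ := h.quad
    exact ⟨ℓ, fun v => (hℓ v).trans (by gcongr)⟩

theorem QuadApprox.add {G H : Cov k → ℂ} {x : Cov k} {ρ C D c : ℝ}
    (hG : QuadApprox G x ρ C c) (hH : QuadApprox H x ρ D c) :
    QuadApprox (fun y => G y + H y) x ρ (C + D) c where
  continuous := hG.continuous.add hH.continuous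
  lip v := by
    calc ‖G (x + v) + H (x + v) - (G x + H x)‖
        = ‖(G (x + v) - G x) + (H (x + v) - H x)‖ := by ring_nf
      _ ≤ _ := norm_add_le_of_le (hG.lip v) (hH.lip v)
      _ = _ := by ring
  quad := by
    obtain ⟨ℓ, hℓ⟩ := hG.quad
    obtain ⟨ℓ', hℓ'⟩ := hH.quad
    refine ⟨ℓ + ℓ', fun v => ?_⟩
    calc ‖G (x + v) + H (x + v) - (G x + H x) - (ℓ + ℓ') v‖
        = ‖(G (x + v) - G x - ℓ v) + (H (x + v) - H x - ℓ' v)‖ := by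
          simp only [_root_.add_apply]; ring_nf
      _ ≤ _ := norm_add_le_of_le (hℓ v) (hℓ' v)
      _ = _ := by ring

/-- The increment of a product is the product of the increments plus two terms linear in one
increment. For the first order bound the product of increments carries a superfluous factor `a =
ρ‖v‖`. It is absorbed by `a ≤ e^a`, whence the `+ 1` in the exponent. -/
theorem QuadApprox.mul {G H : Cov k → ℂ} {x : Cov k} {ρ C D c d : ℝ} (hρ : 0 ≤ ρ)
    (hC : 0 ≤ C) (hD : 0 ≤ D) (hc : 0 ≤ c) (hd : 0 ≤ d)
    (hG : QuadApprox G x ρ C c) (hH : QuadApprox H x ρ D d) :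
    QuadApprox (fun y => G y * H y) x ρ (C * D + ‖G x‖ * D + ‖H x‖ * C) (c + d + 1) := by
  have key : ∀ a : ℝ, 0 ≤ a → ∀ b ≤ c + d, Real.exp (b * a) ≤ Real.exp ((c + d + 1) * a) :=
    fun a ha b hb => Real.exp_le_exp.2 (by nlinarith)
  have key' : ∀ a : ℝ, 0 ≤ a →
      a * (Real.exp (c * a) * Real.exp (d * a)) ≤ Real.exp ((c + d + 1) * a) := by
    intro a ha
    calc a * (Real.exp (c * a) * Real.exp (d * a))
        ≤ Real.exp a * (Real.exp (c * a) * Real.exp (d * a)) := by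
          gcongr; linarith [Real.add_one_le_exp a]
      _ = _ := by rw [← Real.exp_add, ← Real.exp_add]; ring_nf
  have key2 : ∀ a : ℝ, 0 ≤ a →
      Real.exp (c * a) * Real.exp (d * a) ≤ Real.exp ((c + d + 1) * a) := by
    intro a ha
    rw [← Real.exp_add, ← add_mul]; exact key a ha _ le_rfl
  refine ⟨hG.continuous.mul hH.continuous, fun v => ?_, ?_⟩
  · have ha : 0 ≤ ρ * ‖v‖ := by positivity
    set a := ρ * ‖v‖
    calc ‖G (x + v) * H (x + v) - G x * H x‖
        = ‖(G (x + v) - G x) * (H (x + v) - H x) + G x * (H (x + v) - H x)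
            + H x * (G (x + v) - G x)‖ := by ring_nf
      _ ≤ ‖G (x + v) - G x‖ * ‖H (x + v) - H x‖ + ‖G x‖ * ‖H (x + v) - H x‖
            + ‖H x‖ * ‖G (x + v) - G x‖ := by
          simp only [← norm_mul]; exact norm_add₃_le
      _ ≤ (C * a * Real.exp (c * a)) * (D * a * Real.exp (d * a))
            + ‖G x‖ * (D * a * Real.exp (d * a)) + ‖H x‖ * (C * a * Real.exp (c * a)) := by
          gcongr
          exacts [hG.lip v, hH.lip v, hH.lip v, hG.lip v]
      _ = C * D * a * (a * (Real.exp (c * a) * Real.exp (d * a)))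
            + ‖G x‖ * D * a * Real.exp (d * a) + ‖H x‖ * C * a * Real.exp (c * a) := by ring
      _ ≤ C * D * a * Real.exp ((c + d + 1) * a) + ‖G x‖ * D * a * Real.exp ((c + d + 1) * a)
            + ‖H x‖ * C * a * Real.exp ((c + d + 1) * a) := by
          gcongr ?_ * ?_ + ?_ * ?_ + ?_ * ?_
          exacts [key' a ha, key a ha d (by linarith), key a ha c (by linarith)]
      _ = _ := by ring
  · obtain ⟨ℓ, hℓ⟩ := hG.quad
    obtain ⟨ℓ', hℓ'⟩ := hH.quad
    -- The linear part is given by the Leibniz rule; the product of increments is already of second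
    -- order.
    refine ⟨G x • ℓ' + H x • ℓ, fun v => ?_⟩
    have ha : 0 ≤ ρ * ‖v‖ := by positivity
    calc ‖G (x + v) * H (x + v) - G x * H x - (G x • ℓ' + H x • ℓ) v‖
        = ‖(G (x + v) - G x) * (H (x + v) - H x) + G x * (H (x + v) - H x - ℓ' v)
            + H x * (G (x + v) - G x - ℓ v)‖ := by
          simp only [_root_.add_apply, _root_.smul_apply, smul_eq_mul]
          ring_nf
      _ ≤ ‖G (x + v) - G x‖ * ‖H (x + v) - H x‖ + ‖G x‖ * ‖H (x + v) - H x - ℓ' v‖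
            + ‖H x‖ * ‖G (x + v) - G x - ℓ v‖ := by
          simp only [← norm_mul]; exact norm_add₃_le
      _ ≤ (C * (ρ * ‖v‖) * Real.exp (c * (ρ * ‖v‖))) * (D * (ρ * ‖v‖) * Real.exp (d * (ρ * ‖v‖)))
            + ‖G x‖ * (D * (ρ * ‖v‖) ^ 2 * Real.exp (d * (ρ * ‖v‖)))
            + ‖H x‖ * (C * (ρ * ‖v‖) ^ 2 * Real.exp (c * (ρ * ‖v‖))) := by
          gcongr
          exacts [hG.lip v, hH.lip v, hℓ' v, hℓ v]
      _ = C * D * (ρ * ‖v‖) ^ 2 * (Real.exp (c * (ρ * ‖v‖)) * Real.exp (d * (ρ * ‖v‖)))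
            + ‖G x‖ * D * (ρ * ‖v‖) ^ 2 * Real.exp (d * (ρ * ‖v‖))
            + ‖H x‖ * C * (ρ * ‖v‖) ^ 2 * Real.exp (c * (ρ * ‖v‖)) := by ring
      _ ≤ C * D * (ρ * ‖v‖) ^ 2 * Real.exp ((c + d + 1) * (ρ * ‖v‖))
            + ‖G x‖ * D * (ρ * ‖v‖) ^ 2 * Real.exp ((c + d + 1) * (ρ * ‖v‖))
            + ‖H x‖ * C * (ρ * ‖v‖) ^ 2 * Real.exp ((c + d + 1) * (ρ * ‖v‖)) := by
          gcongr ?_ * ?_ + ?_ * ?_ + ?_ * ?_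
          exacts [key2 _ ha, key _ ha d (by linarith), key _ ha c (by linarith)]
      _ = _ := by ring

theorem BoundedDerivs.norm_sub_le {g : Cov k → ℝ} (hg : ContDiff ℝ 2 g) {C : ℝ}
    (hC : ∀ x, ‖iteratedFDeriv ℝ 1 g x‖ ≤ C) (x y : Cov k) : |g y - g x| ≤ C * ‖y - x‖ := by
  refine Convex.norm_image_sub_le_of_norm_fderiv_le (𝕜 := ℝ) (s := Set.univ) (f := g)
    (fun z _ => (hg.differentiable (by norm_num)).differentiableAt) (fun z _ => ?_) convex_univ
    (Set.mem_univ _) (Set.mem_univ _)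
  rw [← norm_iteratedFDeriv_one]; exact hC z

/-- The mean value inequality is used twice: for the derivative, which is therefore Lipschitz, and
then for `g` on the ball of radius `‖v‖`. The loss of the factor `1/2` of Taylor's formula is
harmless. -/
theorem BoundedDerivs.norm_sub_sub_le {g : Cov k → ℝ} (hg : ContDiff ℝ 2 g) {C : ℝ}
    (hC : ∀ x, ‖iteratedFDeriv ℝ 2 g x‖ ≤ C) (x v : Cov k) :
    |g (x + v) - g x - fderiv ℝ g x v| ≤ C * ‖v‖ ^ 2 := by
  have hC0 : 0 ≤ C := (norm_nonneg _).trans (hC x)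
  have hd : ContDiff ℝ 1 (fderiv ℝ g) := hg.fderiv_right (by norm_num)
  have hlip : ∀ z, ‖fderiv ℝ g z - fderiv ℝ g x‖ ≤ C * ‖z - x‖ := fun z => by
    refine Convex.norm_image_sub_le_of_norm_fderiv_le (𝕜 := ℝ) (s := Set.univ)
      (fun z _ => (hd.differentiable (by norm_num)).differentiableAt) (fun z _ => ?_) convex_univ
      (Set.mem_univ _) (Set.mem_univ _)
    rw [← norm_iteratedFDeriv_one, norm_iteratedFDeriv_fderiv]; exact hC z
  have := Convex.norm_image_sub_le_of_norm_fderiv_le' (𝕜 := ℝ) (s := Metric.closedBall x ‖v‖)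
    (f := g) (φ := fderiv ℝ g x) (C := C * ‖v‖) (x := x) (y := x + v)
    (fun z _ => (hg.differentiable (by norm_num)).differentiableAt)
    (fun z hz => (hlip z).trans (by
      rw [mem_closedBall_iff_norm] at hz; gcongr))
    (convex_closedBall _ _) (by simp) (by simp)
  simpa [pow_two, mul_assoc] using this

theorem BoundedDerivs.quadApprox {g : Cov k → ℝ} (hg : ContDiff ℝ 2 g) (h : BoundedDerivs g) :
    ∃ C : ℝ, 0 ≤ C ∧ (∀ x y, |g y - g x| ≤ C * ‖y - x‖) ∧
      (∀ x v, |g (x + v) - g x - fderiv ℝ g x v| ≤ C * ‖v‖ ^ 2) ∧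
      ∀ x, QuadApprox (fun y => (g y : ℂ)) x 1 C 0 := by
  obtain ⟨C, hC⟩ := h
  have h1 := BoundedDerivs.norm_sub_le hg fun x => (hC x).1
  have h2 := BoundedDerivs.norm_sub_sub_le hg fun x => (hC x).2
  refine ⟨C, (norm_nonneg _).trans (hC 0).1, h1, h2, fun x => ?_⟩
  refine ⟨Complex.continuous_ofReal.comp hg.continuous, fun v => ?_,
    Complex.ofRealCLM.comp (fderiv ℝ g x), fun v => ?_⟩
  · have := h1 x (x + v)
    rw [← Complex.ofReal_sub, Complex.norm_real]
    simpa using this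
  · have := h2 x v
    simp only [ContinuousLinearMap.comp_apply, Complex.ofRealCLM_apply]
    rw [← Complex.ofReal_sub, ← Complex.ofReal_sub, Complex.norm_real]
    simpa using this

/-- A complex `z` covers both the generating function (`z = t`) and the characteristic function (`z
= is`). The exponential series is cut after one or two terms, the argument being at most `C ρ‖v‖`.
In the constant, `C ^ 2` comes from that remainder and `C` from the Taylor remainder of `m`. -/
theorem QuadApprox.exp {m : Cov k → ℝ} (hm : Continuous m) {C : ℝ} (hC : 0 ≤ C) {x : Cov k}
    (hlip : ∀ v, |m (x + v) - m x| ≤ C * ‖v‖)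
    (hquad : ∀ v, |m (x + v) - m x - fderiv ℝ m x v| ≤ C * ‖v‖ ^ 2)
    {z : ℂ} {ρ : ℝ} (hρ : 1 ≤ ρ) (hz : ‖z‖ ≤ ρ) :
    QuadApprox (fun y => Complex.exp (z * (m y - m x : ℝ))) x ρ (C ^ 2 + C) C := by
  have hb : ∀ v, ‖z * (m (x + v) - m x : ℝ)‖ ≤ C * (ρ * ‖v‖) := fun v => by
    rw [norm_mul, Complex.norm_real, Real.norm_eq_abs]
    calc ‖z‖ * |m (x + v) - m x| ≤ ρ * (C * ‖v‖) := by gcongr; exact hlip v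
      _ = _ := by ring
  refine ⟨by fun_prop, fun v => ?_, z • Complex.ofRealCLM.comp (fderiv ℝ m x), fun v => ?_⟩
  · have h1 := Complex.norm_exp_sub_sum_le_norm_mul_exp (z * (m (x + v) - m x : ℝ)) 1
    simp only [Finset.range_one, Finset.sum_singleton, pow_zero, Nat.factorial_zero, Nat.cast_one,
      div_one, pow_one] at h1
    simp only [sub_self, Complex.ofReal_zero, mul_zero, Complex.exp_zero]
    calc _ ≤ _ := h1
      _ ≤ (C * (ρ * ‖v‖)) * Real.exp (C * (ρ * ‖v‖)) := by
          gcongr <;> exact hb v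
      _ ≤ _ := by gcongr; nlinarith
  · have h1 := Complex.norm_exp_sub_sum_le_norm_mul_exp (z * (m (x + v) - m x : ℝ)) 2
    simp only [Finset.sum_range_succ, Finset.range_zero, Finset.sum_empty, pow_zero,
      Nat.factorial_zero, Nat.cast_one, div_one, pow_one, Nat.factorial_one, zero_add] at h1
    simp only [sub_self, Complex.ofReal_zero, mul_zero, Complex.exp_zero]
    have h2 : ‖z * (m (x + v) - m x - fderiv ℝ m x v : ℝ)‖ ≤ C * (ρ * ‖v‖) ^ 2 := by
      rw [norm_mul, Complex.norm_real, Real.norm_eq_abs]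
      calc ‖z‖ * |m (x + v) - m x - fderiv ℝ m x v| ≤ ρ * (C * ‖v‖ ^ 2) := by
            gcongr; exact hquad v
        _ = C * ‖v‖ ^ 2 * ρ := by ring
        -- The remainder of `m` is multiplied by `z` only once; `1 ≤ ρ` brings it to the common form
        -- `(ρ‖v‖)²`.
        _ ≤ C * ‖v‖ ^ 2 * ρ ^ 2 := by gcongr; nlinarith
        _ = _ := by ring
    calc _ = ‖(Complex.exp (z * (m (x + v) - m x : ℝ)) - (1 + z * (m (x + v) - m x : ℝ)))
          + z * (m (x + v) - m x - fderiv ℝ m x v : ℝ)‖ := by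
            simp only [_root_.smul_apply, ContinuousLinearMap.comp_apply,
              Complex.ofRealCLM_apply, smul_eq_mul]
            push_cast; ring_nf
      _ ≤ ‖z * (m (x + v) - m x : ℝ)‖ ^ 2 * Real.exp ‖z * (m (x + v) - m x : ℝ)‖
          + C * (ρ * ‖v‖) ^ 2 := norm_add_le_of_le h1 h2
      _ ≤ (C * (ρ * ‖v‖)) ^ 2 * Real.exp (C * (ρ * ‖v‖))
          + C * (ρ * ‖v‖) ^ 2 * Real.exp (C * (ρ * ‖v‖)) := by
            refine add_le_add ?_ ?_
            · gcongr <;> exact hb v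
            · refine le_mul_of_one_le_right (by positivity) (Real.one_le_exp (by positivity))
      _ = _ := by ring

end QuadraticApproximation

/-! ### Integrals against the kernel and the smoothing bias. -/

section KernelIntegrals

variable {k : ℕ} {K : Cov k → ℝ} {α : ℝ}

/-- A measurable kernel of second order with exponential moments of order `α`. -/
structure KernelEnvelope (K : Cov k → ℝ) (α : ℝ) : Prop where
  measurable : Measurable K
  pos : 0 < α
  integrable : Integrable K
  integral_eq_one : ∫ u, K u = 1
  first_moment : ∫ u, K u • u = 0
  exp_norm_sq : Integrable (fun u => Real.exp (α * ‖u‖) * |K u| * ‖u‖ ^ 2)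
  exp_sq : Integrable (fun u => Real.exp (α * ‖u‖) * K u ^ 2)

/-- An integrable kernel is only almost everywhere measurable, whereas composing it with the sample
calls for a measurable one. The change on a null set is undone in `nadarayaWatson_ae_eq`. -/
theorem IsKernel.exists_envelope (hK : IsKernel K) :
    ∃ (K' : Cov k → ℝ) (α : ℝ), KernelEnvelope K' α ∧ K' =ᵐ[volume] K := by
  obtain ⟨α, hα, hint⟩ := hK.exp_moment
  have hae : hK.integrable.1.mk K =ᵐ[volume] K := hK.integrable.1.ae_eq_mk.symm
  refine ⟨hK.integrable.1.mk K, α, ⟨hK.integrable.1.stronglyMeasurable_mk.measurable, hα,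
    hK.integrable.congr hae.symm, ?_, ?_, ?_, ?_⟩, hae⟩
  · rw [integral_congr_ae hae, hK.integral_eq_one]
  · rw [← hK.first_moment]
    refine integral_congr_ae ?_
    filter_upwards [hae] with u hu
    rw [hu]
  · refine (hint α le_rfl).1.congr ?_
    filter_upwards [hae] with u hu
    rw [hu]
  · refine (hint α le_rfl).2.congr ?_
    filter_upwards [hae] with u hu
    rw [hu]

/-- The weight `‖u‖ ^ 2` can be dropped: inside the unit ball the exponential is bounded and `K` is
integrable, outside it `‖u‖ ^ 2 ≥ 1`. -/
theorem KernelEnvelope.exp_abs (hK : KernelEnvelope K α) :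
    Integrable (fun u => Real.exp (α * ‖u‖) * |K u|) := by
  have hm := hK.measurable
  refine ((hK.integrable.abs.const_mul (Real.exp α)).add hK.exp_norm_sq).mono'
    (by fun_prop) (ae_of_all _ fun u => ?_)
  have hα := hK.pos
  simp only [Pi.add_apply, Real.norm_eq_abs, abs_mul, Real.abs_exp, abs_abs]
  rcases le_total ‖u‖ 1 with h | h
  · have : Real.exp (α * ‖u‖) ≤ Real.exp α := Real.exp_le_exp.2 (by nlinarith)
    have h2 : Real.exp (α * ‖u‖) * |K u| ≤ Real.exp α * |K u| := by gcongr
    have h3 : 0 ≤ Real.exp (α * ‖u‖) * |K u| * ‖u‖ ^ 2 := by positivity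
    linarith
  · have h2 : 0 ≤ Real.exp α * |K u| := by positivity
    have h3 : Real.exp (α * ‖u‖) * |K u| * 1 ≤ Real.exp (α * ‖u‖) * |K u| * ‖u‖ ^ 2 := by
      gcongr; nlinarith
    linarith

theorem KernelEnvelope.integrable_mul (hK : KernelEnvelope K α) {H : Cov k → ℂ}
    (hH : AEStronglyMeasurable H) {B : ℝ} (hB : ∀ u, ‖H u‖ ≤ B * Real.exp (α * ‖u‖)) :
    Integrable (fun u => (K u : ℂ) * H u) := by
  refine (hK.exp_abs.const_mul B).mono'
    ((Complex.measurable_ofReal.comp hK.measurable).aestronglyMeasurable.mul hH)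
    (ae_of_all _ fun u => ?_)
  rw [norm_mul, Complex.norm_real, Real.norm_eq_abs]
  calc |K u| * ‖H u‖ ≤ |K u| * (B * Real.exp (α * ‖u‖)) := by gcongr; exact hB u
    _ = _ := by ring

theorem KernelEnvelope.norm_integral_mul_le (hK : KernelEnvelope K α) {H : Cov k → ℂ} {B : ℝ}
    (hB : ∀ u, ‖H u‖ ≤ B * Real.exp (α * ‖u‖)) :
    ‖∫ u, (K u : ℂ) * H u‖ ≤ B * ∫ u, Real.exp (α * ‖u‖) * |K u| := by
  rw [← integral_const_mul]
  refine norm_integral_le_of_norm_le (hK.exp_abs.const_mul B) (ae_of_all _ fun u => ?_)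
  rw [norm_mul, Complex.norm_real, Real.norm_eq_abs]
  calc |K u| * ‖H u‖ ≤ |K u| * (B * Real.exp (α * ‖u‖)) := by gcongr; exact hB u
    _ = _ := by ring

theorem KernelEnvelope.integrable_smul (hK : KernelEnvelope K α) :
    Integrable (fun u => K u • u) := by
  have hm := hK.measurable
  refine (hK.exp_abs.const_mul α⁻¹).mono' (by fun_prop) (ae_of_all _ fun u => ?_)
  have hα := hK.pos
  rw [norm_smul, Real.norm_eq_abs]
  have h1 : ‖u‖ ≤ α⁻¹ * Real.exp (α * ‖u‖) := by
    rw [← div_eq_inv_mul, le_div_iff₀ hα]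
    linarith [Real.add_one_le_exp (α * ‖u‖)]
  calc |K u| * ‖u‖ ≤ |K u| * (α⁻¹ * Real.exp (α * ‖u‖)) := by gcongr
    _ = _ := by ring

/-- The bias of kernel smoothing is of second order in the bandwidth. -/
theorem KernelEnvelope.bias (hK : KernelEnvelope K α) {H : Cov k → ℂ} {x : Cov k} {ρ C c h : ℝ}
    (hH : QuadApprox H x ρ C c) (hC : 0 ≤ C) (hh : 0 < h) (hα : c * (ρ * h) ≤ α) :
    Integrable (fun u => (K u : ℂ) * H (x + h • u)) ∧
    ‖(∫ u, (K u : ℂ) * H (x + h • u)) - H x‖ ≤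
      C * (ρ * h) ^ 2 * ∫ u, Real.exp (α * ‖u‖) * |K u| * ‖u‖ ^ 2 := by
  obtain ⟨ℓ, hℓ⟩ := hH.quad
  have hm := hK.measurable
  have hcont := hH.continuous
  have hi1 : Integrable (fun u => (K u : ℂ) * H x) := hK.integrable.ofReal.mul_const _
  have hi2 : Integrable (fun u => (h : ℂ) * ℓ (K u • u)) :=
    (ℓ.integrable_comp hK.integrable_smul).const_mul _
  have hnorm : ∀ u : Cov k, ‖h • u‖ = h * ‖u‖ := fun u => by
    rw [norm_smul, Real.norm_eq_abs, abs_of_pos hh]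
  have hb : ∀ u, ‖(K u : ℂ) * (H (x + h • u) - H x - ℓ (h • u))‖ ≤
      C * (ρ * h) ^ 2 * (Real.exp (α * ‖u‖) * |K u| * ‖u‖ ^ 2) := fun u => by
    rw [norm_mul, Complex.norm_real, Real.norm_eq_abs]
    calc |K u| * ‖H (x + h • u) - H x - ℓ (h • u)‖
        ≤ |K u| * (C * (ρ * ‖h • u‖) ^ 2 * Real.exp (c * (ρ * ‖h • u‖))) := by
          gcongr; exact hℓ _
      _ = |K u| * (C * (ρ * h * ‖u‖) ^ 2 * Real.exp (c * (ρ * h) * ‖u‖)) := by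
          rw [hnorm]; ring_nf
      -- The growth of `H` at scale `ρ h` is absorbed by the exponential moment of the kernel.
      _ ≤ |K u| * (C * (ρ * h * ‖u‖) ^ 2 * Real.exp (α * ‖u‖)) := by gcongr
      _ = _ := by ring
  have hi3 : Integrable (fun u => (K u : ℂ) * (H (x + h • u) - H x - ℓ (h • u))) := by
    refine (hK.exp_norm_sq.const_mul (C * (ρ * h) ^ 2)).mono' ?_ (ae_of_all _ hb)
    refine ((Complex.measurable_ofReal.comp hm).aestronglyMeasurable).mul ?_
    exact Continuous.aestronglyMeasurable (by fun_prop)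
  -- Constant, linear and remainder parts: the first integrates to `H x` because the kernel has mass
  -- one, the second to zero by the vanishing first moment.
  have heq : (fun u => (K u : ℂ) * H (x + h • u)) = fun u => (K u : ℂ) * H x +
      (h : ℂ) * ℓ (K u • u) + (K u : ℂ) * (H (x + h • u) - H x - ℓ (h • u)) := by
    ext u
    simp only [map_smul, Complex.real_smul]
    ring
  have hi12 : Integrable (fun u => (K u : ℂ) * H x + (h : ℂ) * ℓ (K u • u)) := hi1.add hi2
  refine ⟨by rw [heq]; exact hi12.add hi3, ?_⟩
  have h1 : ∫ u, (K u : ℂ) * H x = H x := by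
    rw [integral_mul_const, integral_complex_ofReal, hK.integral_eq_one]; simp
  have h2 : ∫ u, (h : ℂ) * ℓ (K u • u) = 0 := by
    rw [integral_const_mul, ContinuousLinearMap.integral_comp_comm ℓ hK.integrable_smul,
      hK.first_moment]; simp
  rw [heq, integral_add hi12 hi3, integral_add hi1 hi2, h1, h2, add_zero, add_sub_cancel_left,
    ← integral_const_mul]
  exact norm_integral_le_of_norm_le (hK.exp_norm_sq.const_mul _) (ae_of_all _ hb)

end KernelIntegrals

/-! ### Chebyshev's inequality for i.i.d. sums. -/

section Chebyshev

variable {Ω : Type*} [MeasurableSpace Ω] {P : Measure Ω} [IsProbabilityMeasure P]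

/-- The second moment is bounded as a `lintegral`, so that the bound also supplies square
integrability. -/
theorem measure_abs_sum_sub_le {Y : ℕ → Ω → ℝ} (hind : iIndepFun Y P)
    (hid : ∀ p, IdentDistrib (Y p) (Y 0) P P) {v : ℝ} (hv : 0 ≤ v)
    (hY : ∫⁻ ω, ‖Y 0 ω‖ₑ ^ 2 ∂P ≤ ENNReal.ofReal v) (n : ℕ) {c : ℝ} (hc : 0 < c) :
    P {ω | c ≤ |∑ p ∈ Finset.range n, Y p ω - n * ∫ ω, Y 0 ω ∂P|} ≤
      ENNReal.ofReal (n * v / c ^ 2) := by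
  have hL0 : MemLp (Y 0) 2 P := by
    refine ⟨(hid 0).aemeasurable_fst.aestronglyMeasurable, ?_⟩
    rw [eLpNorm_lt_top_iff_lintegral_rpow_enorm_lt_top (by norm_num) (by norm_num)]
    simpa using hY.trans_lt ENNReal.ofReal_lt_top
  have hL : ∀ p, MemLp (Y p) 2 P := fun p => (hid p).memLp_iff.2 hL0
  have hvar0 : variance (Y 0) P ≤ v := by
    refine (variance_le_expectation_sq hL0.1).trans ?_
    rw [← ENNReal.ofReal_le_ofReal_iff hv]
    refine le_trans (le_of_eq ?_) hY
    change ENNReal.ofReal (∫ ω, Y 0 ω ^ 2 ∂P) = _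
    rw [ofReal_integral_eq_lintegral_ofReal hL0.integrable_sq (ae_of_all _ fun ω => sq_nonneg _)]
    refine lintegral_congr fun ω => ?_
    rw [← ofReal_norm, ← ENNReal.ofReal_pow (norm_nonneg _)]
    simp
  have hvar : variance (∑ p ∈ Finset.range n, Y p) P ≤ n * v := by
    rw [IndepFun.variance_sum (fun p _ => hL p) (fun i _ j _ hij => hind.indepFun hij)]
    calc ∑ p ∈ Finset.range n, variance (Y p) P = ∑ p ∈ Finset.range n, variance (Y 0) P :=
          Finset.sum_congr rfl fun p _ => (hid p).variance_eq
      _ = n * variance (Y 0) P := by simp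
      _ ≤ n * v := by gcongr
  have hmean : ∫ ω, (∑ p ∈ Finset.range n, Y p) ω ∂P = n * ∫ ω, Y 0 ω ∂P := by
    simp only [Finset.sum_apply]
    rw [integral_finsetSum _ fun p _ => (hL p).integrable (by norm_num)]
    simp [fun p => (hid p).integral_eq]
  have := meas_ge_le_variance_div_sq (memLp_finsetSum' (Finset.range n) fun p _ => hL p) hc
  rw [hmean] at this
  simp only [Finset.sum_apply] at this
  exact this.trans (ENNReal.ofReal_le_ofReal (by gcongr))

/-- If the modulus exceeds `c`, the real or the imaginary part reaches `c / 2`. Each costs `4 n v /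
c ^ 2`, hence the `8`. -/
theorem measure_norm_sum_sub_le {ξ : ℕ → Ω → ℂ} (hind : iIndepFun ξ P)
    (hid : ∀ p, IdentDistrib (ξ p) (ξ 0) P P) {v : ℝ} (hv : 0 ≤ v)
    (hξ : ∫⁻ ω, ‖ξ 0 ω‖ₑ ^ 2 ∂P ≤ ENNReal.ofReal v) (n : ℕ) {c : ℝ} (hc : 0 < c) :
    P {ω | c < ‖∑ p ∈ Finset.range n, ξ p ω - n * ∫ ω, ξ 0 ω ∂P‖} ≤
      ENNReal.ofReal (8 * (n * v / c ^ 2)) := by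
  have hL0 : MemLp (ξ 0) 2 P := by
    refine ⟨(hid 0).aemeasurable_fst.aestronglyMeasurable, ?_⟩
    rw [eLpNorm_lt_top_iff_lintegral_rpow_enorm_lt_top (by norm_num) (by norm_num)]
    simpa using hξ.trans_lt ENNReal.ofReal_lt_top
  have hint : Integrable (ξ 0) P := hL0.integrable (by norm_num)
  have hre := measure_abs_sum_sub_le (hind.comp (fun _ => Complex.re) fun _ => by fun_prop)
    (fun p => (hid p).comp (by fun_prop)) hv
    ((lintegral_mono fun ω => by
      simp only [Function.comp_apply]
      gcongr
      rw [enorm_le_iff_norm_le]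
      exact Complex.abs_re_le_norm _).trans hξ) n (half_pos hc)
  have him := measure_abs_sum_sub_le (hind.comp (fun _ => Complex.im) fun _ => by fun_prop)
    (fun p => (hid p).comp (by fun_prop)) hv
    ((lintegral_mono fun ω => by
      simp only [Function.comp_apply]
      gcongr
      rw [enorm_le_iff_norm_le]
      exact Complex.abs_im_le_norm _).trans hξ) n (half_pos hc)
  simp only [Function.comp_apply] at hre him
  rw [show ∫ ω, (ξ 0 ω).re ∂P = (∫ ω, ξ 0 ω ∂P).re from integral_re hint] at hre
  rw [show ∫ ω, (ξ 0 ω).im ∂P = (∫ ω, ξ 0 ω ∂P).im from integral_im hint] at him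
  refine (measure_mono fun ω hω => ?_).trans ((measure_union_le _ _).trans
    ((add_le_add hre him).trans (le_of_eq ?_)))
  · simp only [Set.mem_union, Set.mem_ofPred_eq] at hω ⊢
    by_contra! hcon
    have := Complex.norm_le_abs_re_add_abs_im
      (∑ p ∈ Finset.range n, ξ p ω - n * ∫ ω, ξ 0 ω ∂P)
    simp only [Complex.sub_re, Complex.sub_im, Complex.re_sum, Complex.im_sum, Complex.mul_re,
      Complex.mul_im, Complex.natCast_re, Complex.natCast_im, zero_mul, sub_zero, add_zero] at this
    linarith [hcon.1, hcon.2]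
  · rw [← ENNReal.ofReal_add (by positivity) (by positivity)]
    congr 1
    field_simp
    ring

end Chebyshev

/-! ### Moments and deviations of one kernel average. -/

section Law

variable {Ω : Type*} [MeasurableSpace Ω] {P : Measure Ω} [IsProbabilityMeasure P] {k : ℕ}
  {X : ℕ → Ω → Cov k} {Z : ℕ → Ω → ℝ} {fX : Cov k → ℝ} {lam : ℝ} {F₁ F₂ : Measure ℝ}
  {m₁ m₂ : Cov k → ℝ}

theorem IsMixtureSample.compProd_eq (hs : IsMixtureSample P X Z fX lam F₁ F₂ m₁ m₂) :
    P.map (fun ω => (X 0 ω, Z 0 ω)) = (P.map (X 0)) ⊗ₘ condDistrib (Z 0) (X 0) P :=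
  (compProd_map_condDistrib (hs.measurable_Z 0).aemeasurable).symm

theorem IsMixtureSample.lintegral_eq (hs : IsMixtureSample P X Z fX lam F₁ F₂ m₁ m₂)
    {Φ : Cov k × ℝ → ENNReal} (hΦ : Measurable Φ) :
    ∫⁻ ω, Φ (X 0 ω, Z 0 ω) ∂P =
      ∫⁻ y, ∫⁻ z, Φ (y, z) ∂shiftMixture lam F₁ F₂ (m₁ y) (m₂ y) ∂(P.map (X 0)) := by
  rw [← lintegral_map hΦ ((hs.measurable_X 0).prodMk (hs.measurable_Z 0)), hs.compProd_eq,
    Measure.lintegral_compProd hΦ]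
  refine lintegral_congr_ae ?_
  filter_upwards [hs.cond_law] with y hy
  rw [hy]

theorem IsMixtureSample.integral_eq (hs : IsMixtureSample P X Z fX lam F₁ F₂ m₁ m₂)
    {Φ : Cov k × ℝ → ℂ} (hΦ : Measurable Φ) (hint : Integrable (fun ω => Φ (X 0 ω, Z 0 ω)) P) :
    ∫ ω, Φ (X 0 ω, Z 0 ω) ∂P =
      ∫ y, ∫ z, Φ (y, z) ∂shiftMixture lam F₁ F₂ (m₁ y) (m₂ y) ∂(P.map (X 0)) := by
  have hm : Measurable (fun ω => (X 0 ω, Z 0 ω)) := (hs.measurable_X 0).prodMk (hs.measurable_Z 0)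
  have hint' : Integrable Φ (P.map (fun ω => (X 0 ω, Z 0 ω))) :=
    (integrable_map_measure hΦ.aestronglyMeasurable hm.aemeasurable).2 hint
  rw [← integral_map (f := Φ) hm.aemeasurable hΦ.aestronglyMeasurable, hs.compProd_eq,
    Measure.integral_compProd (hs.compProd_eq ▸ hint')]
  refine integral_congr_ae ?_
  filter_upwards [hs.cond_law] with y hy
  rw [hy]

theorem IsMixtureSample.map_le (hs : IsMixtureSample P X Z fX lam F₁ F₂ m₁ m₂) {Cf : ℝ}
    (hCf : ∀ x, fX x ≤ Cf) : P.map (X 0) ≤ ENNReal.ofReal Cf • volume := by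
  rw [hs.density, ← withDensity_const]
  exact withDensity_mono (ae_of_all _ fun x => ENNReal.ofReal_le_ofReal (hCf x))

/-- The smoothed contribution of one observation to a Nadaraya–Watson numerator. -/
def kernelTerm (K : Cov k → ℝ) (h : ℝ) (x : Cov k) (w : ℝ → ℂ) (q : Cov k × ℝ) : ℂ :=
  w q.2 * (K (h⁻¹ • (q.1 - x)) : ℂ)

theorem measurable_kernelTerm {K : Cov k → ℝ} (hK : Measurable K) (h : ℝ) (x : Cov k) {w : ℝ → ℂ}
    (hw : Measurable w) : Measurable (kernelTerm K h x w) := by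
  unfold kernelTerm
  fun_prop

/-- Conditioning on `X` and substituting `u = (y - x) / h` produces the Jacobian `h ^ k`. The
density enters only through its upper bound. -/
theorem IsMixtureSample.second_moment_le (hs : IsMixtureSample P X Z fX lam F₁ F₂ m₁ m₂)
    {K : Cov k → ℝ} {α : ℝ} (hK : KernelEnvelope K α) {Cf : ℝ} (hCf : ∀ x, fX x ≤ Cf)
    {h : ℝ} (hh : 0 < h) (x : Cov k) {w : ℝ → ℂ} (hw : Measurable w) {B : ℝ} (hB : 0 ≤ B)
    (hwB : ∀ u, ∫⁻ z, ‖w z‖ₑ ^ 2 ∂shiftMixture lam F₁ F₂ (m₁ (x + h • u)) (m₂ (x + h • u)) ≤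
      ENNReal.ofReal (B * Real.exp (α * ‖u‖))) :
    ∫⁻ ω, ‖kernelTerm K h x w (X 0 ω, Z 0 ω)‖ₑ ^ 2 ∂P ≤
      ENNReal.ofReal (h ^ k * (Cf * B * ∫ u, Real.exp (α * ‖u‖) * K u ^ 2)) := by
  have hCf0 : 0 ≤ Cf := (hs.density_nonneg 0).trans (hCf 0)
  have hm := hK.measurable
  let F : Cov k → ℝ := fun u => B * (Real.exp (α * ‖u‖) * K u ^ 2)
  have hF : Integrable F := hK.exp_sq.const_mul B
  have hF' : Integrable (fun y => F (h⁻¹ • (y - x))) :=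
    (hF.comp_smul (inv_ne_zero hh.ne')).comp_sub_right x
  calc ∫⁻ ω, ‖kernelTerm K h x w (X 0 ω, Z 0 ω)‖ₑ ^ 2 ∂P
      = ∫⁻ y, ∫⁻ z, ‖kernelTerm K h x w (y, z)‖ₑ ^ 2 ∂shiftMixture lam F₁ F₂ (m₁ y) (m₂ y)
          ∂(P.map (X 0)) :=
        hs.lintegral_eq (Φ := fun q => ‖kernelTerm K h x w q‖ₑ ^ 2)
          ((measurable_kernelTerm hm h x hw).enorm.pow_const 2)
    _ ≤ ∫⁻ y, ENNReal.ofReal (F (h⁻¹ • (y - x))) ∂(P.map (X 0)) := by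
        refine lintegral_mono fun y => ?_
        simp only [kernelTerm, enorm_mul, mul_pow]
        rw [lintegral_mul_const _ (by fun_prop)]
        have h1 := hwB (h⁻¹ • (y - x))
        rw [smul_inv_smul₀ hh.ne', add_sub_cancel] at h1
        calc _ ≤ ENNReal.ofReal (B * Real.exp (α * ‖h⁻¹ • (y - x)‖)) *
              ‖(K (h⁻¹ • (y - x)) : ℂ)‖ₑ ^ 2 := by gcongr
          _ = _ := by
            rw [← ofReal_norm, ← ENNReal.ofReal_pow (norm_nonneg _),
              ← ENNReal.ofReal_mul (by positivity), Complex.norm_real, Real.norm_eq_abs, sq_abs,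
              mul_assoc]
    _ ≤ ∫⁻ y, ENNReal.ofReal (F (h⁻¹ • (y - x))) ∂(ENNReal.ofReal Cf • volume) :=
        lintegral_mono' (hs.map_le hCf) le_rfl
    _ = ENNReal.ofReal (Cf * ∫ y, F (h⁻¹ • (y - x))) := by
        rw [lintegral_smul_measure, ← ofReal_integral_eq_lintegral_ofReal hF'
          (ae_of_all _ fun y => by positivity), smul_eq_mul, ENNReal.ofReal_mul hCf0]
    _ = _ := by
        rw [integral_sub_right_eq_self (fun y => F (h⁻¹ • y)) x,
          Measure.integral_comp_inv_smul_of_nonneg _ _ hh.le, integral_const_mul, smul_eq_mul,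
          finrank_euclideanSpace_fin]
        ring_nf

theorem IsMixtureSample.mean_eq (hs : IsMixtureSample P X Z fX lam F₁ F₂ m₁ m₂)
    {K : Cov k → ℝ} (hK : Measurable K) (hfX : Measurable fX) {h : ℝ} (hh : 0 < h) (x : Cov k)
    {w : ℝ → ℂ} (hw : Measurable w)
    (hint : Integrable (fun ω => kernelTerm K h x w (X 0 ω, Z 0 ω)) P) :
    ∫ ω, kernelTerm K h x w (X 0 ω, Z 0 ω) ∂P =
      (h : ℂ) ^ k * ∫ u, (K u : ℂ) * ((fX (x + h • u) : ℂ) *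
        ∫ z, w z ∂shiftMixture lam F₁ F₂ (m₁ (x + h • u)) (m₂ (x + h • u))) := by
  let G : Cov k → ℂ := fun y => (fX y : ℂ) * ∫ z, w z ∂shiftMixture lam F₁ F₂ (m₁ y) (m₂ y)
  let H : Cov k → ℂ := fun u => (K u : ℂ) * G (x + h • u)
  rw [hs.integral_eq (measurable_kernelTerm hK h x hw) hint, hs.density,
    integral_withDensity_eq_integral_toReal_smul (by fun_prop) (ae_of_all _ fun _ => by simp)]
  have h1 : ∀ y, (ENNReal.ofReal (fX y)).toReal •
      ∫ z, kernelTerm K h x w (y, z) ∂shiftMixture lam F₁ F₂ (m₁ y) (m₂ y) =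
        H (h⁻¹ • (y - x)) := fun y => by
    simp only [kernelTerm, H, G]
    rw [integral_mul_const, ENNReal.toReal_ofReal (hs.density_nonneg y), smul_inv_smul₀ hh.ne',
      add_sub_cancel, Complex.real_smul]
    ring
  simp_rw [h1]
  rw [integral_sub_right_eq_self (fun y => H (h⁻¹ • y)) x,
    Measure.integral_comp_inv_smul_of_nonneg _ _ hh.le, finrank_euclideanSpace_fin,
    Complex.real_smul, Complex.ofReal_pow]

/-- Chebyshev bound for a kernel average around its smoothed mean. -/
theorem IsMixtureSample.deviation (hs : IsMixtureSample P X Z fX lam F₁ F₂ m₁ m₂)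
    {K : Cov k → ℝ} {α : ℝ} (hK : KernelEnvelope K α) (hfX : Measurable fX) {Cf : ℝ}
    (hCf : ∀ x, fX x ≤ Cf) {h : ℝ} (hh : 0 < h) (x : Cov k) {w : ℝ → ℂ} (hw : Measurable w)
    {B : ℝ} (hB : 0 ≤ B)
    (hwB : ∀ u, ∫⁻ z, ‖w z‖ₑ ^ 2 ∂shiftMixture lam F₁ F₂ (m₁ (x + h • u)) (m₂ (x + h • u)) ≤
      ENNReal.ofReal (B * Real.exp (α * ‖u‖))) {n : ℕ} (hn : 0 < n) {c : ℝ} (hc : 0 < c) :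
    P {ω | c < ‖(∑ p ∈ Finset.range n, kernelTerm K h x w (X p ω, Z p ω)) / (n * (h : ℂ) ^ k)
      - ∫ u, (K u : ℂ) * ((fX (x + h • u) : ℂ) *
        ∫ z, w z ∂shiftMixture lam F₁ F₂ (m₁ (x + h • u)) (m₂ (x + h • u)))‖} ≤
      ENNReal.ofReal (8 * (Cf * B * ∫ u, Real.exp (α * ‖u‖) * K u ^ 2) / (n * h ^ k * c ^ 2)) := by
  have hCf0 : 0 ≤ Cf := (hs.density_nonneg 0).trans (hCf 0)
  have hsec := hs.second_moment_le hK hCf hh x hw hB hwB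
  have hI : 0 ≤ ∫ u, Real.exp (α * ‖u‖) * K u ^ 2 := integral_nonneg fun u => by positivity
  set I := ∫ u, Real.exp (α * ‖u‖) * K u ^ 2
  have hmt := measurable_kernelTerm hK.measurable h x hw
  have hmp : ∀ p, Measurable fun ω => (X p ω, Z p ω) := fun p =>
    (hs.measurable_X p).prodMk (hs.measurable_Z p)
  have hint : Integrable (fun ω => kernelTerm K h x w (X 0 ω, Z 0 ω)) P := by
    refine MemLp.integrable (q := 2) (by norm_num)
      ⟨(hmt.comp (hmp 0)).aestronglyMeasurable, ?_⟩
    rw [eLpNorm_lt_top_iff_lintegral_rpow_enorm_lt_top (by norm_num) (by norm_num)]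
    simpa using hsec.trans_lt ENNReal.ofReal_lt_top
  have hnh : 0 < n * h ^ k := by positivity
  -- The threshold is scaled by the normalization `n h^k`; against a second moment of order `h^k`
  -- this leaves `1 / (n h^k c²)`.
  have hcheb := measure_norm_sum_sub_le (ξ := fun p ω => kernelTerm K h x w (X p ω, Z p ω))
    (hs.indep.comp (fun _ => kernelTerm K h x w) fun _ => hmt) (fun p => (hs.ident p).comp hmt)
    (by positivity) hsec n (c := c * (n * h ^ k)) (by positivity)
  rw [hs.mean_eq hK.measurable hfX hh x hw hint] at hcheb
  refine (measure_mono fun ω hω => ?_).trans (hcheb.trans (ENNReal.ofReal_le_ofReal (le_of_eq ?_)))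
  · simp only [Set.mem_ofPred_eq] at hω ⊢
    have hne : ((n : ℂ) * (h : ℂ) ^ k) ≠ 0 := by exact_mod_cast hnh.ne'
    have hnorm : ‖(n : ℂ) * (h : ℂ) ^ k‖ = n * h ^ k := by
      rw [norm_mul, norm_pow, Complex.norm_real, Complex.norm_natCast, Real.norm_eq_abs,
        abs_of_pos hh]
    rw [← mul_assoc, ← mul_assoc]
    rw [div_sub' hne, norm_div, hnorm, lt_div_iff₀ hnh, ← mul_assoc] at hω
    exact hω
  · field_simp

end Law

/-! ### The general rate of a Nadaraya–Watson estimator. -/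

section Rate

variable {Ω : Type*} [MeasurableSpace Ω] {P : Measure Ω} [IsProbabilityMeasure P] {k : ℕ}
  {X : ℕ → Ω → Cov k} {Z : ℕ → Ω → ℝ} {fX : Cov k → ℝ} {lam : ℝ} {F₁ F₂ : Measure ℝ}
  {m₁ m₂ : Cov k → ℝ}

theorem isProbabilityMeasure_shiftMixture [IsProbabilityMeasure F₁] [IsProbabilityMeasure F₂]
    (hlam : lam ∈ Set.Ioo (0 : ℝ) 1) (c₁ c₂ : ℝ) :
    IsProbabilityMeasure (shiftMixture lam F₁ F₂ c₁ c₂) := by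
  have h1 : IsProbabilityMeasure (F₁.map (fun e => c₁ + e)) :=
    Measure.isProbabilityMeasure_map (by fun_prop)
  have h2 : IsProbabilityMeasure (F₂.map (fun e => c₂ + e)) :=
    Measure.isProbabilityMeasure_map (by fun_prop)
  refine ⟨?_⟩
  rw [shiftMixture, Measure.add_apply, Measure.smul_apply, Measure.smul_apply, measure_univ,
    measure_univ, smul_eq_mul, smul_eq_mul, mul_one, mul_one,
    ← ENNReal.ofReal_add hlam.1.le (by linarith [hlam.2])]
  simp

/-- The rate of a Nadaraya–Watson estimator: approximation error `δ`, bias `(ρ h)^2` and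
variance `V / (n h^k)`. -/
def nwRate (k : ℕ) (h ρ δ V : ℕ → ℝ) (n : ℕ) : ℝ :=
  δ n + √((ρ n * h n) ^ 4 + V n / (n * h n ^ k))

theorem sq_le_sqrt_add {a b : ℝ} (hb : 0 ≤ b) : a ^ 2 ≤ √(a ^ 4 + b) :=
  Real.le_sqrt_of_sq_le (by nlinarith)

/-- The regression function is a dominant part `Ga`, smooth at scale `1/ρ`, plus a part `Gb` of
which only the size `δ` is known. The first has a second order bias, the second is estimated in
absolute value. The `c + 1` is the exponent of the product of `fX` and `Ga` from `QuadApprox.mul`.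
-/
theorem IsMixtureSample.bias_le (hs : IsMixtureSample P X Z fX lam F₁ F₂ m₁ m₂)
    {K : Cov k → ℝ} {α : ℝ} (hK : KernelEnvelope K α) (hfX : Continuous fX) {x : Cov k}
    {Cf : ℝ} (hCf : ∀ x, fX x ≤ Cf) (hCf0 : 0 ≤ Cf) (hf : QuadApprox (fun y => (fX y : ℂ)) x 1 Cf 0)
    {Ga Gb : Cov k → ℂ} {ρ h δ C c : ℝ} (hC : 0 ≤ C) (hc : 0 ≤ c) (hρ : 1 ≤ ρ) (hh : 0 < h)
    (hρh : (c + 1) * (ρ * h) ≤ α) (hδ : 0 ≤ δ) (hGa : QuadApprox Ga x ρ C c)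
    (hGb : Continuous Gb) (hGb' : ∀ v, ‖Gb (x + v)‖ ≤ C * δ * Real.exp (c * (ρ * ‖v‖))) :
    ‖(∫ u, (K u : ℂ) * ((fX (x + h • u) : ℂ) * (Ga (x + h • u) + Gb (x + h • u))))
        - fX x * Ga x‖ ≤
      (Cf * C + fX x * C + ‖Ga x‖ * Cf) * (ρ * h) ^ 2 *
        (∫ u, Real.exp (α * ‖u‖) * |K u| * ‖u‖ ^ 2) +
      Cf * C * δ * ∫ u, Real.exp (α * ‖u‖) * |K u| := by
  have hf' : QuadApprox (fun y => (fX y : ℂ)) x ρ Cf 0 :=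
    hf.mono zero_le_one hρ hCf0 le_rfl le_rfl le_rfl
  have hfx : ‖(fX x : ℂ)‖ = fX x := by
    rw [Complex.norm_real, Real.norm_eq_abs, abs_of_nonneg (hs.density_nonneg x)]
  have hH := QuadApprox.mul (by linarith) hCf0 hC le_rfl hc hf' hGa
  rw [hfx, zero_add] at hH
  have hfx0 := hs.density_nonneg x
  obtain ⟨hi1, hb1⟩ := hK.bias hH (by positivity) hh hρh
  have hbd : ∀ u, ‖(fX (x + h • u) : ℂ) * Gb (x + h • u)‖ ≤ Cf * C * δ * Real.exp (α * ‖u‖) := by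
    intro u
    rw [norm_mul, Complex.norm_real, Real.norm_eq_abs, abs_of_nonneg (hs.density_nonneg _)]
    calc fX (x + h • u) * ‖Gb (x + h • u)‖
        ≤ Cf * (C * δ * Real.exp (c * (ρ * ‖h • u‖))) := by
          gcongr
          exacts [hCf _, hGb' _]
      _ ≤ Cf * (C * δ * Real.exp (α * ‖u‖)) := by
          gcongr ?_ * (_ * Real.exp ?_)
          rw [norm_smul, Real.norm_eq_abs, abs_of_pos hh]
          have : 0 ≤ ρ * h := by positivity
          have h2 : c * (ρ * h) ≤ α := by nlinarith
          calc c * (ρ * (h * ‖u‖)) = c * (ρ * h) * ‖u‖ := by ring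
            _ ≤ α * ‖u‖ := by gcongr
      _ = _ := by ring
  have hi2 : Integrable (fun u => (K u : ℂ) * ((fX (x + h • u) : ℂ) * Gb (x + h • u))) :=
    hK.integrable_mul (Continuous.aestronglyMeasurable (by fun_prop)) hbd
  have hb2 := hK.norm_integral_mul_le hbd
  have heq : (fun u => (K u : ℂ) * ((fX (x + h • u) : ℂ) * (Ga (x + h • u) + Gb (x + h • u)))) =
      fun u => (K u : ℂ) * ((fX (x + h • u) : ℂ) * Ga (x + h • u)) +
        (K u : ℂ) * ((fX (x + h • u) : ℂ) * Gb (x + h • u)) := by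
    ext u; ring
  rw [heq, integral_add hi1 hi2, add_sub_right_comm]
  exact norm_add_le_of_le hb1 hb2

/-- Stochastic order of a normalized kernel average. -/
theorem IsMixtureSample.kernelAverage_rate (hs : IsMixtureSample P X Z fX lam F₁ F₂ m₁ m₂)
    {K : Cov k → ℝ} {α : ℝ} (hK : KernelEnvelope K α) (hfX : Continuous fX) {x : Cov k}
    {Cf : ℝ} (hCf : ∀ x, fX x ≤ Cf) (hf : QuadApprox (fun y => (fX y : ℂ)) x 1 Cf 0)
    {h : ℕ → ℝ} (hh : ∀ n, 0 < h n) {w : ℕ → ℝ → ℂ} (hw : ∀ n, Measurable (w n)) {τ : ℂ}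
    {Ga Gb : ℕ → Cov k → ℂ} {ρ δ V : ℕ → ℝ} {C c : ℝ} (hC : 0 ≤ C) (hc : 0 ≤ c)
    (hρ : ∀ᶠ n in atTop, 1 ≤ ρ n) (hδ : ∀ᶠ n in atTop, 0 ≤ δ n) (hV : ∀ᶠ n in atTop, 1 ≤ V n)
    (hρh : Tendsto (fun n => ρ n * h n) atTop (𝓝 0))
    (hG : ∀ᶠ n in atTop, ∀ y, ∫ z, w n z ∂shiftMixture lam F₁ F₂ (m₁ y) (m₂ y) = Ga n y + Gb n y)
    (hGa : ∀ᶠ n in atTop, QuadApprox (Ga n) x (ρ n) C c ∧ Ga n x = τ)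
    (hGb : ∀ᶠ n in atTop, Continuous (Gb n) ∧
      ∀ v, ‖Gb n (x + v)‖ ≤ C * δ n * Real.exp (c * (ρ n * ‖v‖)))
    (hwV : ∀ᶠ n in atTop, ∀ v,
      ∫⁻ z, ‖w n z‖ₑ ^ 2 ∂shiftMixture lam F₁ F₂ (m₁ (x + v)) (m₂ (x + v)) ≤
        ENNReal.ofReal (C * V n * Real.exp (c * (ρ n * ‖v‖)))) :
    StochBdd P (fun n ω => ‖(∑ p ∈ Finset.range n, kernelTerm K (h n) x (w n) (X p ω, Z p ω)) /
      (n * (h n : ℂ) ^ k) - fX x * τ‖) (nwRate k h ρ δ V) := by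
  intro η hη
  have hCf0 : 0 ≤ Cf := (hs.density_nonneg 0).trans (hCf 0)
  have hfx0 := hs.density_nonneg x
  have hα := hK.pos
  have hI0 : 0 ≤ ∫ u, Real.exp (α * ‖u‖) * K u ^ 2 := integral_nonneg fun u => by positivity
  have hI1 : 0 ≤ ∫ u, Real.exp (α * ‖u‖) * |K u| := integral_nonneg fun u => by positivity
  have hI2 : 0 ≤ ∫ u, Real.exp (α * ‖u‖) * |K u| * ‖u‖ ^ 2 :=
    integral_nonneg fun u => by positivity
  have hbias := fun n (h1 : 1 ≤ ρ n) (h2 : (c + 1) * (ρ n * h n) ≤ α) (h3 : 0 ≤ δ n)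
    (h4 : QuadApprox (Ga n) x (ρ n) C c) (h5 : Continuous (Gb n)) h6 =>
    hs.bias_le hK hfX hCf hCf0 hf hC hc h1 (hh n) h2 h3 h4 h5 h6
  have hdev := fun n (hn : 0 < n) (B : ℝ) (hB : 0 ≤ B) hwB (c : ℝ) (hc : 0 < c) =>
    hs.deviation hK hfX.measurable hCf (hh n) x (hw n) (B := B) hB hwB hn (c := c) hc
  set I₀ := ∫ u, Real.exp (α * ‖u‖) * K u ^ 2
  set I₁ := ∫ u, Real.exp (α * ‖u‖) * |K u|
  set I₂ := ∫ u, Real.exp (α * ‖u‖) * |K u| * ‖u‖ ^ 2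
  -- `A` covers the deterministic bias and `D` the fluctuations: `D` is large enough for Chebyshev's
  -- bound to be at most `η`, and the `+ 1` under the root keeps it positive.
  set A := (Cf * C + fX x * C + ‖τ‖ * Cf) * I₂ + Cf * C * I₁
  set D := √(8 * (Cf * C * I₀) / η + 1)
  have hD2 : D ^ 2 = 8 * (Cf * C * I₀) / η + 1 := Real.sq_sqrt (by positivity)
  have hD : 0 < D := Real.sqrt_pos.2 (by positivity)
  have hsmall : ∀ᶠ n in atTop, (c + 1) * (ρ n * h n) ≤ α := by
    have : Tendsto (fun n => (c + 1) * (ρ n * h n)) atTop (𝓝 0) := by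
      simpa using hρh.const_mul (c + 1)
    exact this.eventually_le_const hα
  refine ⟨A + D, ?_⟩
  filter_upwards [hρ, hδ, hV, hG, hGa, hGb, hwV, hsmall, eventually_gt_atTop 0] with
    n h1 h2 h3 h4 h5 h6 h7 h8 hn
  have hhn := hh n
  have hnh : 0 < n * h n ^ k := by positivity
  -- The rate dominates each source of error. It is strictly positive because `1 ≤ V n`, so `D * r`
  -- is an admissible Chebyshev threshold.
  have hr : V n / (n * h n ^ k) ≤ nwRate k h ρ δ V n ^ 2 ∧ 0 < nwRate k h ρ δ V n ∧
      (ρ n * h n) ^ 2 ≤ nwRate k h ρ δ V n ∧ δ n ≤ nwRate k h ρ δ V n := by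
    have hq : 0 < V n / (n * h n ^ k) := by positivity
    have hs1 : 0 < √((ρ n * h n) ^ 4 + V n / (n * h n ^ k)) := Real.sqrt_pos.2 (by positivity)
    have hs2 := Real.sq_sqrt (show 0 ≤ (ρ n * h n) ^ 4 + V n / (n * h n ^ k) by positivity)
    have hs3 := sq_le_sqrt_add (a := ρ n * h n) hq.le
    have h4 : 0 ≤ (ρ n * h n) ^ 4 := by positivity
    unfold nwRate
    refine ⟨by nlinarith, by linarith, by linarith, by linarith⟩
  obtain ⟨hr1, hr2, hr3, hr4⟩ := hr
  set r := nwRate k h ρ δ V n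
  have hb := hbias n h1 h8 h2 h5.1 h6.1 h6.2
  simp only [← h4, h5.2] at hb
  have hb' := hb.trans (show _ ≤ A * r by
    calc _ ≤ (Cf * C + fX x * C + ‖τ‖ * Cf) * r * I₂ + Cf * C * r * I₁ := by gcongr
      _ = A * r := by simp only [A]; ring)
  have hd := hdev n hn (C * V n) (by positivity) (fun u => (h7 (h n • u)).trans
    (ENNReal.ofReal_le_ofReal (by
      gcongr _ * Real.exp ?_
      rw [norm_smul, Real.norm_eq_abs, abs_of_pos hhn]
      have : 0 ≤ ρ n * h n := by positivity
      have h2 : c * (ρ n * h n) ≤ α := by nlinarith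
      calc c * (ρ n * (h n * ‖u‖)) = c * (ρ n * h n) * ‖u‖ := by ring
        _ ≤ α * ‖u‖ := by gcongr))) (D * r) (by positivity)
  refine (measure_mono fun ω hω => ?_).trans (hd.trans (ENNReal.ofReal_le_ofReal ?_))
  · simp only [Set.mem_ofPred_eq] at hω ⊢
    by_contra! hcon
    have := norm_add_le_of_le hcon hb'
    rw [sub_add_sub_cancel] at this
    linarith
  · calc 8 * (Cf * (C * V n) * I₀) / (n * h n ^ k * (D * r) ^ 2)
        = 8 * (Cf * C * I₀) * (V n / (n * h n ^ k)) / (D ^ 2 * r ^ 2) := by field_simp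
      _ ≤ 8 * (Cf * C * I₀) * r ^ 2 / (D ^ 2 * r ^ 2) := by gcongr
      _ = 8 * (Cf * C * I₀) / D ^ 2 := by field_simp
      _ ≤ η := by
        rw [div_le_iff₀ (by positivity), hD2, mul_add, mul_div_cancel₀ _ hη.ne']
        linarith

theorem nadarayaWatson_eq (K : Cov k → ℝ) (n : ℕ) (h : ℝ) (x : Cov k) (X : ℕ → Cov k) (Z : ℕ → ℝ)
    (w : ℝ → ℂ) : nadarayaWatson K n h X (fun p => w (Z p)) x =
      (∑ p ∈ Finset.range n, kernelTerm K h x w (X p, Z p)) /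
        ∑ p ∈ Finset.range n, kernelTerm K h x (fun _ => 1) (X p, Z p) := by
  simp [nadarayaWatson, kernelTerm]

/-- The set where the kernels differ stays Lebesgue null under the affine change of variable, hence
null for the law of each `X p`, which has a density. There are countably many `p`. -/
theorem IsMixtureSample.nadarayaWatson_ae_eq (hs : IsMixtureSample P X Z fX lam F₁ F₂ m₁ m₂)
    {K K' : Cov k → ℝ} (hKK' : K =ᵐ[volume] K') {h : ℝ} (hh : 0 < h) (x : Cov k) (n : ℕ)
    (w : ℝ → ℂ) : ∀ᵐ ω ∂P,
      nadarayaWatson K n h (fun p => X p ω) (fun p => w (Z p ω)) x =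
        nadarayaWatson K' n h (fun p => X p ω) (fun p => w (Z p ω)) x := by
  have h1 : ∀ᵐ u : Cov k, K (h⁻¹ • u) = K' (h⁻¹ • u) := by
    refine ae_of_ae_map (f := fun u : Cov k => h⁻¹ • u) (p := fun u => K u = K' u)
      (by fun_prop) ?_
    rw [Measure.map_addHaar_smul _ (inv_ne_zero hh.ne')]
    exact Measure.ae_smul_measure hKK' _
  have h2 : ∀ᵐ y : Cov k, K (h⁻¹ • (y - x)) = K' (h⁻¹ • (y - x)) :=
    (measurePreserving_sub_right volume x).quasiMeasurePreserving.ae h1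
  have h3 : ∀ p, ∀ᵐ ω ∂P, K (h⁻¹ • (X p ω - x)) = K' (h⁻¹ • (X p ω - x)) := fun p => by
    refine ae_of_ae_map (f := X p) (p := fun y => K (h⁻¹ • (y - x)) = K' (h⁻¹ • (y - x)))
      (hs.measurable_X p).aemeasurable ?_
    have : P.map (X p) = P.map (X 0) := ((hs.ident p).comp measurable_fst).map_eq
    rw [this, hs.density]
    exact (withDensity_absolutelyContinuous _ _).ae_le h2
  filter_upwards [ae_all_iff.2 h3] with ω hω
  simp only [nadarayaWatson, hω]

/-- Stochastic order of the error of a Nadaraya–Watson estimator. -/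
theorem IsMixtureSample.nadarayaWatson_rate [IsProbabilityMeasure F₁] [IsProbabilityMeasure F₂]
    (hs : IsMixtureSample P X Z fX lam F₁ F₂ m₁ m₂) (hlam : lam ∈ Set.Ioo (0 : ℝ) 1)
    {K : Cov k → ℝ} (hK : IsKernel K) (hfX : ContDiff ℝ 2 fX) (hfX_bdd : ∃ C, ∀ x, |fX x| ≤ C)
    (hfX' : BoundedDerivs fX) {x : Cov k} (hfx : 0 < fX x)
    {h : ℕ → ℝ} (hh : ∀ n, 0 < h n) {w : ℕ → ℝ → ℂ} (hw : ∀ n, Measurable (w n)) {τ : ℂ}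
    {Ga Gb : ℕ → Cov k → ℂ} {ρ δ V : ℕ → ℝ} {C c : ℝ} (hC : 0 ≤ C) (hc : 0 ≤ c)
    (hρ : ∀ᶠ n in atTop, 1 ≤ ρ n) (hδ : ∀ᶠ n in atTop, 0 ≤ δ n) (hV : ∀ᶠ n in atTop, 1 ≤ V n)
    (hρh : Tendsto (fun n => ρ n * h n) atTop (𝓝 0))
    (hG : ∀ᶠ n in atTop, ∀ y, ∫ z, w n z ∂shiftMixture lam F₁ F₂ (m₁ y) (m₂ y) = Ga n y + Gb n y)
    (hGa : ∀ᶠ n in atTop, QuadApprox (Ga n) x (ρ n) C c ∧ Ga n x = τ)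
    (hGb : ∀ᶠ n in atTop, Continuous (Gb n) ∧
      ∀ v, ‖Gb n (x + v)‖ ≤ C * δ n * Real.exp (c * (ρ n * ‖v‖)))
    (hwV : ∀ᶠ n in atTop, ∀ v,
      ∫⁻ z, ‖w n z‖ₑ ^ 2 ∂shiftMixture lam F₁ F₂ (m₁ (x + v)) (m₂ (x + v)) ≤
        ENNReal.ofReal (C * V n * Real.exp (c * (ρ n * ‖v‖))))
    (hr : Tendsto (nwRate k h ρ δ V) atTop (𝓝 0)) :
    StochBdd P (fun n ω => ‖nadarayaWatson K n (h n) (fun p => X p ω) (fun p => w n (Z p ω)) x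
      - τ‖) (nwRate k h ρ δ V) := by
  obtain ⟨K', α, hK', hKK'⟩ := hK.exists_envelope
  obtain ⟨C₁, hC₁⟩ := hfX_bdd
  obtain ⟨C₂, hC₂, -, -, hq⟩ := hfX'.quadApprox hfX
  have hCf : ∀ y, fX y ≤ max C₁ C₂ := fun y =>
    (le_abs_self _).trans ((hC₁ y).trans (le_max_left _ _))
  have hq' : QuadApprox (fun y => (fX y : ℂ)) x 1 (max C₁ C₂) 0 :=
    (hq x).mono zero_le_one le_rfl hC₂ (le_max_right _ _) le_rfl le_rfl
  have hnum := hs.kernelAverage_rate hK' hfX.continuous hCf hq' hh hw hC hc hρ hδ hV hρh hG hGa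
    hGb hwV
  -- The denominator is the average with weight `1`; it obeys the rate of the numerator since `0 ≤ δ
  -- n` and `1 ≤ V n`.
  have hden := hs.kernelAverage_rate (w := fun _ _ => 1) (τ := 1) (Ga := fun _ _ => 1)
    (Gb := fun _ _ => 0) (C := 1) (c := 0) hK' hfX.continuous hCf hq' hh
    (fun _ => measurable_const) zero_le_one le_rfl hρ hδ hV hρh
    (Eventually.of_forall fun n y => by
      have := isProbabilityMeasure_shiftMixture (F₁ := F₁) (F₂ := F₂) hlam (m₁ y) (m₂ y)
      simp)
    (by
      filter_upwards [hρ] with n hn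
      exact ⟨QuadApprox.const 1 x 0 (by linarith) zero_le_one, rfl⟩)
    (by
      filter_upwards [hδ] with n hn
      exact ⟨continuous_const, fun v => by simpa using hn⟩)
    (by
      filter_upwards [hV] with n hn v
      have := isProbabilityMeasure_shiftMixture (F₁ := F₁) (F₂ := F₂) hlam
        (m₁ (x + v)) (m₂ (x + v))
      simpa using hn)
  have hmain : StochBdd P (fun n ω => ‖nadarayaWatson K' n (h n) (fun p => X p ω)
      (fun p => w n (Z p ω)) x - τ‖) (nwRate k h ρ δ V) := by
    -- Where the errors of both averages sum to at most `fX x / 2`, the denominator has modulus at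
    -- least `fX x / 2`, and the quotient is controlled linearly by the two errors.
    refine (hnum.add hden).transfer' hr (δ := fX x / 2) (C := (1 + ‖τ‖) * (2 / fX x))
      (by positivity) (by positivity) ?_
    filter_upwards [eventually_gt_atTop 0] with n hn ω hω
    have hhn := hh n
    have hne : ((n : ℂ) * (h n : ℂ) ^ k) ≠ 0 := by
      exact_mod_cast (show 0 < n * h n ^ k by positivity).ne'
    rw [nadarayaWatson_eq, ← div_div_div_cancel_right₀ hne]
    set S := (∑ p ∈ Finset.range n, kernelTerm K' (h n) x (w n) (X p ω, Z p ω)) /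
      (n * (h n : ℂ) ^ k)
    set D := (∑ p ∈ Finset.range n, kernelTerm K' (h n) x (fun _ => 1) (X p ω, Z p ω)) /
      (n * (h n : ℂ) ^ k)
    rw [mul_one] at hω ⊢
    have hDlow : fX x / 2 ≤ ‖D‖ := by
      have h1 : ‖(fX x : ℂ)‖ = fX x := by
        rw [Complex.norm_real, Real.norm_eq_abs, abs_of_pos hfx]
      have h2 := norm_sub_norm_le (fX x : ℂ) D
      rw [norm_sub_rev, h1] at h2
      have h3 := norm_nonneg (S - fX x * τ)
      linarith
    have hDpos : 0 < ‖D‖ := lt_of_lt_of_le (by positivity) hDlow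
    have hD0 : D ≠ 0 := norm_pos_iff.1 hDpos
    have heq : S / D - τ = ((S - fX x * τ) - τ * (D - fX x)) / D := by field_simp; ring
    rw [heq, norm_div]
    calc _ ≤ (‖S - fX x * τ‖ + ‖τ‖ * ‖D - fX x‖) / (fX x / 2) := by
          gcongr
          rw [← norm_mul]; exact norm_sub_le _ _
      _ ≤ ((1 + ‖τ‖) * (‖S - fX x * τ‖ + ‖D - fX x‖)) / (fX x / 2) := by
          gcongr
          nlinarith [norm_nonneg τ, norm_nonneg (S - fX x * τ), norm_nonneg (D - fX x)]
      _ = _ := by field_simp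
  refine hmain.congr_ae fun n => ?_
  filter_upwards [hs.nadarayaWatson_ae_eq hKK' (hh n) x n (w n)] with ω hω
  rw [hω]

end Rate

/-! ### Integrals with respect to the shifted mixture. -/

section Mixture

variable {lam : ℝ} {F₁ F₂ : Measure ℝ}

theorem lintegral_shiftMixture {Φ : ℝ → ENNReal} (hΦ : Measurable Φ) (c₁ c₂ : ℝ) :
    ∫⁻ z, Φ z ∂shiftMixture lam F₁ F₂ c₁ c₂ =
      ENNReal.ofReal lam * ∫⁻ e, Φ (c₁ + e) ∂F₁ +
        ENNReal.ofReal (1 - lam) * ∫⁻ e, Φ (c₂ + e) ∂F₂ := by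
  rw [shiftMixture, lintegral_add_measure, lintegral_smul_measure, lintegral_smul_measure,
    lintegral_map hΦ (by fun_prop), lintegral_map hΦ (by fun_prop), smul_eq_mul, smul_eq_mul]

theorem integral_shiftMixture (hlam : lam ∈ Set.Ioo (0 : ℝ) 1) {w : ℝ → ℂ} (hw : Measurable w)
    {c₁ c₂ : ℝ} (h1 : Integrable (fun e => w (c₁ + e)) F₁)
    (h2 : Integrable (fun e => w (c₂ + e)) F₂) :
    ∫ z, w z ∂shiftMixture lam F₁ F₂ c₁ c₂ =
      lam * ∫ e, w (c₁ + e) ∂F₁ + (1 - lam) * ∫ e, w (c₂ + e) ∂F₂ := by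
  have h1' : Integrable w (F₁.map (fun e => c₁ + e)) :=
    (integrable_map_measure hw.aestronglyMeasurable (by fun_prop)).2 h1
  have h2' : Integrable w (F₂.map (fun e => c₂ + e)) :=
    (integrable_map_measure hw.aestronglyMeasurable (by fun_prop)).2 h2
  rw [shiftMixture, integral_add_measure (h1'.smul_measure ENNReal.ofReal_ne_top)
    (h2'.smul_measure ENNReal.ofReal_ne_top), integral_smul_measure, integral_smul_measure,
    integral_map (by fun_prop) hw.aestronglyMeasurable,
    integral_map (by fun_prop) hw.aestronglyMeasurable,
    ENNReal.toReal_ofReal hlam.1.le, ENNReal.toReal_ofReal (by linarith [hlam.2]),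
    Complex.real_smul, Complex.real_smul]
  push_cast
  rfl

theorem lintegral_shiftMixture_le (hlam : lam ∈ Set.Ioo (0 : ℝ) 1) {Φ : ℝ → ENNReal}
    (hΦ : Measurable Φ) {c₁ c₂ B₁ B₂ : ℝ} (hB₁ : 0 ≤ B₁) (hB₂ : 0 ≤ B₂)
    (h1 : ∫⁻ e, Φ (c₁ + e) ∂F₁ ≤ ENNReal.ofReal B₁)
    (h2 : ∫⁻ e, Φ (c₂ + e) ∂F₂ ≤ ENNReal.ofReal B₂) :
    ∫⁻ z, Φ z ∂shiftMixture lam F₁ F₂ c₁ c₂ ≤ ENNReal.ofReal (lam * B₁ + (1 - lam) * B₂) := by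
  have hl := hlam.1.le
  have hl' : 0 ≤ 1 - lam := by linarith [hlam.2]
  rw [lintegral_shiftMixture hΦ, ENNReal.ofReal_add (by positivity) (by positivity),
    ENNReal.ofReal_mul hl, ENNReal.ofReal_mul hl']
  gcongr

theorem integral_cexp_add {F : Measure ℝ} (s c : ℝ) :
    ∫ e, Complex.exp (Complex.I * s * (c + e : ℝ)) ∂F =
      Complex.exp (Complex.I * s * c) * charFun F s := by
  rw [charFun_apply_real, ← integral_const_mul]
  refine integral_congr_ae (ae_of_all _ fun e => ?_)
  simp only [← Complex.exp_add]
  push_cast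
  ring_nf

theorem integrable_cexp_add {F : Measure ℝ} [IsFiniteMeasure F] (s c : ℝ) :
    Integrable (fun e : ℝ => Complex.exp (Complex.I * s * (c + e : ℝ))) F := by
  refine Integrable.of_bound (C := 1) (Continuous.aestronglyMeasurable (by fun_prop))
    (ae_of_all _ fun e => ?_)
  rw [mul_assoc, ← Complex.ofReal_mul, Complex.norm_exp_I_mul_ofReal]

theorem integral_exp_add {F : Measure ℝ} (t c : ℝ) :
    ∫ e, Real.exp (t * (c + e)) ∂F = Real.exp (t * c) * mgf id F t := by
  rw [mgf, ← integral_const_mul]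
  refine integral_congr_ae (ae_of_all _ fun e => ?_)
  simp only [← Real.exp_add, id]
  ring_nf

theorem integrable_exp_add {F : Measure ℝ} {t : ℝ} (hF : Integrable (fun e => Real.exp (t * e)) F)
    (c : ℝ) : Integrable (fun e => Real.exp (t * (c + e))) F := by
  refine (hF.const_mul (Real.exp (t * c))).congr (ae_of_all _ fun e => ?_)
  simp only [← Real.exp_add]
  ring_nf

/-- The variance of `e^{te}` is nonnegative. This makes the variance factor of the generating
function estimator at least one. -/
theorem sq_mgf_le {F : Measure ℝ} [IsProbabilityMeasure F] {t : ℝ}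
    (hF : Integrable (fun e => Real.exp (2 * t * e)) F) : mgf id F t ^ 2 ≤ mgf id F (2 * t) := by
  have hsq : ∀ e, Real.exp (t * e) ^ 2 = Real.exp (2 * t * e) := fun e => by
    rw [← Real.exp_nat_mul]; ring_nf
  have hL : MemLp (fun e => Real.exp (t * e)) 2 F := by
    rw [memLp_two_iff_integrable_sq (Continuous.aestronglyMeasurable (by fun_prop))]
    simpa only [hsq] using hF
  have h1 := variance_nonneg (fun e => Real.exp (t * e)) F
  rw [variance_eq_sub hL] at h1
  simp only [Pi.pow_apply, hsq] at h1
  simpa [mgf] using h1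

end Mixture

section NadarayaWatson

variable {k : ℕ}

theorem nadarayaWatson_div_const (K : Cov k → ℝ) (n : ℕ) (h : ℝ) (X : ℕ → Cov k) (Y : ℕ → ℂ)
    (x : Cov k) (c : ℂ) : nadarayaWatson K n h X (fun p => Y p / c) x =
      nadarayaWatson K n h X Y x / c := by
  simp only [nadarayaWatson, div_mul_eq_mul_div, ← Finset.sum_div]
  rw [div_right_comm]

theorem ofReal_nadarayaWatson (K : Cov k → ℝ) (n : ℕ) (h : ℝ) (X : ℕ → Cov k) (Y : ℕ → ℝ)
    (x : Cov k) : ((nadarayaWatson K n h X Y x : ℝ) : ℂ) =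
      nadarayaWatson K n h X (fun p => (Y p : ℂ)) x := by
  simp [nadarayaWatson]

end NadarayaWatson

/-! ### Relative errors of the characteristic and moment generating function estimators. -/

section Applications

variable {Ω : Type*} [MeasurableSpace Ω] {P : Measure Ω} [IsProbabilityMeasure P] {k : ℕ}
  {X : ℕ → Ω → Cov k} {Z : ℕ → Ω → ℝ} {fX : Cov k → ℝ} {lam : ℝ} {F₁ F₂ : Measure ℝ}
  [IsProbabilityMeasure F₁] [IsProbabilityMeasure F₂] {m₁ m₂ : Cov k → ℝ}

theorem cfError_nonneg (T : Tuning) (F₂ : Measure ℝ) (n : ℕ) (s : ℝ) :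
    0 ≤ cfError k T F₂ n s := Real.sqrt_nonneg _

/-- Relative error of the estimated conditional characteristic function. -/
theorem IsMixtureSample.hatCf_rate
    (hs : IsMixtureSample P X Z fX lam F₁ F₂ m₁ m₂) (hlam : lam ∈ Set.Ioo (0 : ℝ) 1)
    {K : Cov k → ℝ} (hK : IsKernel K) (hfX : ContDiff ℝ 2 fX) (hfX_bdd : ∃ C, ∀ x, |fX x| ≤ C)
    (hfX' : BoundedDerivs fX) {x : Cov k} (hfx : 0 < fX x) (hm₁ : ContDiff ℝ 2 m₁)
    (hm₂ : ContDiff ℝ 2 m₂) (hm₂' : BoundedDerivs m₂) (T : Tuning) (hb : ∀ n, 0 < T.b n)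
    (hs₀ : Tendsto T.s atTop atTop) (hsb : Tendsto (fun n => T.s n * T.b n) atTop (𝓝 0))
    {σ : ℕ → ℝ} (hσ : Tendsto σ atTop atTop) (hσs : ∀ᶠ n in atTop, |σ n| ≤ 2 * T.s n)
    {f : ℝ → ℝ} (hf : ∀ s, 0 ≤ f s)
    (hφ₂ : ∀ᶠ s : ℝ in atTop, charFun F₂ s ≠ 0)
    (hφ : (fun s : ℝ => charFun F₁ s / charFun F₂ s) =O[atTop] f)
    (hr : Tendsto (fun n => f (σ n) + cfError k T F₂ n (σ n)) atTop (𝓝 0)) :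
    StochBdd P (fun n ω => ‖hatCf K T n (fun p => X p ω) (fun p => Z p ω) x (σ n) /
      ((1 - lam) * charFun F₂ (σ n) * Complex.exp (Complex.I * σ n * m₂ x)) - 1‖)
      (fun n => f (σ n) + cfError k T F₂ n (σ n)) := by
  obtain ⟨C₂, hC₂, hlip, hquad, -⟩ := hm₂'.quadApprox hm₂
  obtain ⟨Cφ, hCφ, hO⟩ := hφ.exists_pos
  have hl := hlam.1
  have hl' : 0 < 1 - lam := by linarith [hlam.2]
  have hlc : (1 - (lam : ℂ)) ≠ 0 := by exact_mod_cast hl'.ne'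
  have hlnorm : ‖(1 - (lam : ℂ))‖ = 1 - lam := by
    rw [← Complex.ofReal_one, ← Complex.ofReal_sub, Complex.norm_real, Real.norm_eq_abs,
      abs_of_pos hl']
  have hexp : ∀ s r : ℝ, ‖Complex.exp (Complex.I * s * r)‖ = 1 := fun s r => by
    rw [mul_assoc, ← Complex.ofReal_mul, Complex.norm_exp_I_mul_ofReal]
  -- The contribution of the second component at `x`. After division by `c n` the target is `1`, the
  -- dominant part is `exp(iσ(m₂ y - m₂ x))` and the first component is `O(f)`.
  set c : ℕ → ℂ := fun n =>
    (1 - lam) * charFun F₂ (σ n) * Complex.exp (Complex.I * σ n * m₂ x) with hc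
  have hcnorm : ∀ n, ‖c n‖ = (1 - lam) * ‖charFun F₂ (σ n)‖ := fun n => by
    simp only [hc, norm_mul, hexp, hlnorm, mul_one]
  set w : ℕ → ℝ → ℂ := fun n z => Complex.exp (Complex.I * σ n * z) / c n
  set V : ℕ → ℝ := fun n => 1 / ‖charFun F₂ (σ n)‖ ^ 2
  have hne := hσ.eventually hφ₂
  have hV1 : ∀ᶠ n in atTop, 1 ≤ V n := by
    filter_upwards [hne] with n hn
    have h1 : 0 < ‖charFun F₂ (σ n)‖ := norm_pos_iff.2 hn
    rw [one_le_div (by positivity)]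
    exact pow_le_one₀ h1.le (norm_charFun_le_one _)
  have hrate : ∀ n, nwRate k T.b (fun n => 2 * T.s n) (fun n => f (σ n)) V n ≤
      4 * (f (σ n) + cfError k T F₂ n (σ n)) := fun n => by
    -- The scale `ρ = 2 s_n` serves both `σ = s_n` and `σ = s_n + a_n`. It multiplies the bias term
    -- under the root by `16`, so the root by at most `4`.
    have h1 : √((2 * T.s n * T.b n) ^ 4 + V n / (n * T.b n ^ k)) ≤ 4 * cfError k T F₂ n (σ n) := by
      have hbn := hb n
      rw [cfError]
      refine Real.sqrt_le_iff.2 ⟨by positivity, ?_⟩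
      rw [mul_pow (4 : ℝ), Real.sq_sqrt (by positivity)]
      have h2 : V n / (n * T.b n ^ k) = 1 / (n * T.b n ^ k * ‖charFun F₂ (σ n)‖ ^ 2) := by
        simp only [V]; rw [div_div, mul_comm]
      rw [h2]
      have h3 : 0 ≤ 1 / (n * T.b n ^ k * ‖charFun F₂ (σ n)‖ ^ 2) := by positivity
      nlinarith
    have := hf (σ n)
    unfold nwRate
    linarith
  have hrate0 : ∀ n, 0 ≤ nwRate k T.b (fun n => 2 * T.s n) (fun n => f (σ n)) V n := fun n =>
    add_nonneg (hf _) (Real.sqrt_nonneg _)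
  have hmain := hs.nadarayaWatson_rate hlam hK hfX hfX_bdd hfX' hfx hb (w := w) (τ := 1)
    (Ga := fun n y => Complex.exp (Complex.I * σ n * (m₂ y - m₂ x : ℝ)))
    (Gb := fun n y => lam * Complex.exp (Complex.I * σ n * m₁ y) * charFun F₁ (σ n) / c n)
    (ρ := fun n => 2 * T.s n) (δ := fun n => f (σ n)) (V := V)
    -- One summand for each requirement: smoothness of the dominant part, size of the negligible
    -- part, second moment.
    (C := (C₂ ^ 2 + C₂) + lam / (1 - lam) * Cφ + 1 / (1 - lam) ^ 2) (c := C₂)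
    (fun n => by fun_prop) (by positivity) hC₂
    (by filter_upwards [hs₀.eventually_ge_atTop 1] with n hn; linarith)
    (Eventually.of_forall fun n => hf _) hV1
    (by simpa [mul_assoc] using hsb.const_mul 2)
    (by
      filter_upwards [hne] with n hn y
      rw [integral_shiftMixture hlam (by fun_prop) ((integrable_cexp_add _ _).div_const _)
        ((integrable_cexp_add _ _).div_const _), integral_div, integral_div, integral_cexp_add,
        integral_cexp_add]
      have h1 : Complex.exp (Complex.I * σ n * m₂ y) =
          Complex.exp (Complex.I * σ n * (m₂ y - m₂ x : ℝ)) *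
            Complex.exp (Complex.I * σ n * m₂ x) := by
        rw [← Complex.exp_add]; push_cast; ring_nf
      rw [h1]
      simp only [hc]
      field_simp [Complex.exp_ne_zero]
      ring)
    (by
      filter_upwards [hσs, hs₀.eventually_ge_atTop 1] with n hn hn'
      refine ⟨?_, by simp⟩
      refine (QuadApprox.exp (m := m₂) hm₂.continuous hC₂ (fun v => by
        simpa using hlip x (x + v)) (hquad x) (ρ := 2 * T.s n) (by linarith) (by
          simpa using hn)).mono (by linarith) le_rfl (by positivity) ?_ hC₂ le_rfl
      rw [add_assoc]
      exact le_add_of_nonneg_right (by positivity))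
    (by
      filter_upwards [hσ.eventually hO.bound, hs₀.eventually_ge_atTop 1] with n hn hn'
      have hmc := hm₁.continuous
      refine ⟨by fun_prop, fun v => ?_⟩
      rw [norm_div] at hn
      rw [norm_div, norm_mul, norm_mul, hexp, hcnorm, Complex.norm_real, Real.norm_eq_abs,
        abs_of_pos hl, mul_one]
      rw [Real.norm_of_nonneg (hf _)] at hn
      have hfn := hf (σ n)
      calc lam * ‖charFun F₁ (σ n)‖ / ((1 - lam) * ‖charFun F₂ (σ n)‖)
          = lam / (1 - lam) * (‖charFun F₁ (σ n)‖ / ‖charFun F₂ (σ n)‖) := by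
            rw [mul_div_mul_comm]
        _ ≤ lam / (1 - lam) * (Cφ * f (σ n)) := by gcongr
        _ = (lam / (1 - lam) * Cφ) * f (σ n) * 1 := by ring
        _ ≤ _ := by
          gcongr
          · have : 0 ≤ (C₂ ^ 2 + C₂) + 1 / (1 - lam) ^ 2 := by positivity
            linarith
          · exact Real.one_le_exp (by positivity))
    (by
      filter_upwards [hne, hs₀.eventually_ge_atTop 1, hV1] with n hn hn' hVn v
      have := isProbabilityMeasure_shiftMixture (F₁ := F₁) (F₂ := F₂) hlam
        (m₁ (x + v)) (m₂ (x + v))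
      have h1 : ∀ z, ‖w n z‖ₑ ^ 2 = ENNReal.ofReal (1 / (1 - lam) ^ 2 * V n) := fun z => by
        rw [← ofReal_norm, ← ENNReal.ofReal_pow (norm_nonneg _)]
        simp only [w, norm_div, hexp, hcnorm, V]
        congr 1
        field_simp
      simp only [h1, lintegral_const, measure_univ, mul_one]
      refine ENNReal.ofReal_le_ofReal ?_
      calc 1 / (1 - lam) ^ 2 * V n = 1 / (1 - lam) ^ 2 * V n * 1 := by ring
        _ ≤ _ := by
          gcongr
          · have : 0 ≤ (C₂ ^ 2 + C₂) + lam / (1 - lam) * Cφ := by positivity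
            linarith
          · exact Real.one_le_exp (by positivity))
    (squeeze_zero hrate0 hrate (by simpa using hr.const_mul 4))
  refine (hmain.mono_rate (Eventually.of_forall hrate0) (Eventually.of_forall hrate)).of_le
    fun n ω => ?_
  simp only [w]
  rw [nadarayaWatson_div_const]
  rfl

/-- Relative error of the estimated conditional moment generating function. -/
theorem IsMixtureSample.hatMgf_rate
    (hs : IsMixtureSample P X Z fX lam F₁ F₂ m₁ m₂) (hlam : lam ∈ Set.Ioo (0 : ℝ) 1)
    {K : Cov k → ℝ} (hK : IsKernel K) (hfX : ContDiff ℝ 2 fX) (hfX_bdd : ∃ C, ∀ x, |fX x| ≤ C)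
    (hfX' : BoundedDerivs fX) {x : Cov k} (hfx : 0 < fX x) (hm₁ : ContDiff ℝ 2 m₁)
    (hm₁' : BoundedDerivs m₁) (hm₂ : ContDiff ℝ 2 m₂) (hm₂' : BoundedDerivs m₂)
    (T : Tuning) (hh : ∀ n, 0 < T.h n)
    (ht : Tendsto T.t atTop atTop) (hth : Tendsto (fun n => T.t n * T.h n) atTop (𝓝 0))
    (hmgf₁ : ∀ t : ℝ, 0 ≤ t → Integrable (fun e => Real.exp (t * e)) F₁)
    (hmgf₂ : ∀ t : ℝ, 0 ≤ t → Integrable (fun e => Real.exp (t * e)) F₂)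
    {μ : ℝ → ℝ} (hμ : ∀ t, 0 ≤ μ t) (hμ₀ : Tendsto μ atTop (𝓝 0))
    (hratio : ∀ η : ℝ, 0 < η →
      (fun t : ℝ => Real.exp (η * t) * (mgf id F₂ t / mgf id F₁ t)) =O[atTop] μ)
    (hr : Tendsto (fun n => μ (T.t n) + √((T.t n * T.h n) ^ 4 + mgfVariance k T F₁ n))
      atTop (𝓝 0)) :
    StochBdd P (fun n ω => ‖(hatMgf K T n (fun p => X p ω) (fun p => Z p ω) x (T.t n) : ℂ) /
      (lam * mgf id F₁ (T.t n) * Real.exp (T.t n * m₁ x) : ℝ) - 1‖)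
      (fun n => μ (T.t n) + √((T.t n * T.h n) ^ 4 + mgfVariance k T F₁ n)) := by
  obtain ⟨C₁, hC₁, hlip₁, hquad₁, -⟩ := hm₁'.quadApprox hm₁
  obtain ⟨C₂, hC₂, hlip₂, -, -⟩ := hm₂'.quadApprox hm₂
  -- `e^{ηt}` outweighs the shift `e^{t(m₂ x - m₁ x)}`, so the second component is negligible even
  -- when `m₂ x` is much larger than `m₁ x`; the `+ 1` ensures `0 < η`.
  set η : ℝ := |m₂ x - m₁ x| + 1
  have hη : 0 < η := by positivity
  obtain ⟨Cμ, hCμ, hO⟩ := (hratio η hη).exists_pos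
  have hl := hlam.1
  have hl' : 0 < 1 - lam := by linarith [hlam.2]
  have hM₁ : ∀ t, 0 ≤ t → 0 < mgf id F₁ t := fun t h => mgf_pos (hmgf₁ t h)
  have hM₂ : ∀ t, 0 ≤ t → 0 < mgf id F₂ t := fun t h => mgf_pos (hmgf₂ t h)
  have hbound : ∀ᶠ t in atTop, Real.exp (η * t) * (mgf id F₂ t / mgf id F₁ t) ≤ Cμ * μ t := by
    filter_upwards [hO.bound, eventually_ge_atTop 0] with t h1 h2
    have := hM₁ t h2
    have := hM₂ t h2
    rwa [Real.norm_of_nonneg (by positivity), Real.norm_of_nonneg (hμ t)] at h1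
  have ht2 : Tendsto (fun n => 2 * T.t n) atTop atTop := ht.const_mul_atTop (by norm_num)
  set c : ℕ → ℝ := fun n => lam * mgf id F₁ (T.t n) * Real.exp (T.t n * m₁ x) with hc
  set w : ℕ → ℝ → ℂ := fun n z => (Real.exp (T.t n * z) : ℂ) / c n
  set V : ℕ → ℝ := fun n => mgf id F₁ (2 * T.t n) / mgf id F₁ (T.t n) ^ 2
  have ht0 := ht.eventually_ge_atTop 1
  have hV1 : ∀ᶠ n in atTop, 1 ≤ V n := by
    filter_upwards [ht0] with n hn
    have h1 := hM₁ (T.t n) (by linarith)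
    rw [one_le_div (by positivity)]
    exact sq_mgf_le (hmgf₁ _ (by linarith))
  have hrate : nwRate k T.h T.t (fun n => μ (T.t n)) V =
      fun n => μ (T.t n) + √((T.t n * T.h n) ^ 4 + mgfVariance k T F₁ n) := by
    ext n
    simp only [nwRate, mgfVariance, V]
    rw [one_div_mul_eq_div]
  have hgrow : ∀ t, 0 ≤ t → ∀ v, Real.exp (t * (m₂ (x + v) - m₁ x)) ≤
      Real.exp (η * t) * Real.exp (t * (C₂ * ‖v‖)) := fun t h0 v => by
    rw [← Real.exp_add]
    refine Real.exp_le_exp.2 ?_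
    have h1 := (le_abs_self _).trans (hlip₂ x (x + v))
    rw [add_sub_cancel_left] at h1
    have h2 := le_abs_self (m₂ x - m₁ x)
    have h3 : m₂ (x + v) - m₁ x ≤ η + C₂ * ‖v‖ := by simp only [η]; linarith
    nlinarith
  have hgrow₁ : ∀ t, 0 ≤ t → ∀ v, Real.exp (t * (m₁ (x + v) - m₁ x)) ≤
      Real.exp (t * (C₁ * ‖v‖)) := fun t h0 v => by
    refine Real.exp_le_exp.2 ?_
    have h1 := (le_abs_self _).trans (hlip₁ x (x + v))
    rw [add_sub_cancel_left] at h1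
    gcongr
  have hsplit : ∀ t a b : ℝ, Real.exp (t * a) = Real.exp (t * (a - b)) * Real.exp (t * b) :=
    fun t a b => by rw [← Real.exp_add]; ring_nf
  rw [← hrate] at hr ⊢
  have hmain := hs.nadarayaWatson_rate hlam hK hfX hfX_bdd hfX' hfx hh (w := w) (τ := 1)
    (Ga := fun n y => Complex.exp (T.t n * (m₁ y - m₁ x : ℝ)))
    (Gb := fun n y => (((1 - lam) / lam * (mgf id F₂ (T.t n) / mgf id F₁ (T.t n)) *
      Real.exp (T.t n * (m₂ y - m₁ x)) : ℝ) : ℂ))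
    (ρ := T.t) (δ := fun n => μ (T.t n)) (V := V)
    -- Again one summand per requirement; the factor `2` in `c` is due to the second moment, which
    -- involves `e^{2tZ}`.
    (C := (C₁ ^ 2 + C₁) + (1 - lam) / lam * Cμ + 1 / lam ^ 2 * (1 + Cμ)) (c := 2 * (C₁ + C₂))
    (fun n => by fun_prop) (by positivity) (by positivity) ht0
    (Eventually.of_forall fun n => hμ _) hV1 hth
    (by
      filter_upwards [ht0] with n hn y
      have hn0 : 0 ≤ T.t n := by linarith
      have h1 := hM₁ _ hn0
      have hint : ∀ (F : Measure ℝ) (a : ℝ), Integrable (fun e => Real.exp (T.t n * e)) F →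
          Integrable (fun e => w n (a + e)) F := fun F a hF =>
        (integrable_exp_add hF a).ofReal.div_const _
      have hval : ∀ (F : Measure ℝ) (a : ℝ), ∫ e, w n (a + e) ∂F =
          ((Real.exp (T.t n * a) * mgf id F (T.t n) / c n : ℝ) : ℂ) := fun F a => by
        simp only [w]
        rw [integral_div, integral_complex_ofReal, integral_exp_add]
        push_cast; rfl
      rw [integral_shiftMixture hlam (by fun_prop) (hint _ _ (hmgf₁ _ hn0))
        (hint _ _ (hmgf₂ _ hn0)), hval, hval, ← Complex.ofReal_mul (T.t n), ← Complex.ofReal_exp]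
      rw [hsplit _ (m₁ y) (m₁ x), hsplit _ (m₂ y) (m₁ x)]
      norm_cast
      simp only [hc]
      have := Real.exp_pos (T.t n * m₁ x)
      field_simp)
    (by
      filter_upwards [ht0] with n hn
      refine ⟨?_, by simp⟩
      refine (QuadApprox.exp (m := m₁) hm₁.continuous hC₁ (fun v => by
        simpa using hlip₁ x (x + v)) (hquad₁ x) (ρ := T.t n) hn (by
          simp [abs_of_nonneg (zero_le_one.trans hn)])).mono (by linarith) le_rfl (by positivity)
          ?_ hC₁ (by linarith)
      rw [add_assoc]
      exact le_add_of_nonneg_right (by positivity))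
    (by
      filter_upwards [ht0, ht.eventually hbound] with n hn hbn
      have hn0 : 0 ≤ T.t n := by linarith
      have h1 := hM₁ _ hn0
      have h2 := hM₂ _ hn0
      have hmc := hm₂.continuous
      have hμn := hμ (T.t n)
      refine ⟨by fun_prop, fun v => ?_⟩
      rw [Complex.norm_real, Real.norm_of_nonneg (by positivity)]
      calc (1 - lam) / lam * (mgf id F₂ (T.t n) / mgf id F₁ (T.t n)) *
            Real.exp (T.t n * (m₂ (x + v) - m₁ x))
          ≤ (1 - lam) / lam * (mgf id F₂ (T.t n) / mgf id F₁ (T.t n)) *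
            (Real.exp (η * T.t n) * Real.exp (T.t n * (C₂ * ‖v‖))) := by
            gcongr; exact hgrow _ hn0 v
        _ = (1 - lam) / lam * (Real.exp (η * T.t n) *
            (mgf id F₂ (T.t n) / mgf id F₁ (T.t n))) * Real.exp (T.t n * (C₂ * ‖v‖)) := by ring
        _ ≤ (1 - lam) / lam * (Cμ * μ (T.t n)) * Real.exp (T.t n * (C₂ * ‖v‖)) := by gcongr
        _ = ((1 - lam) / lam * Cμ) * μ (T.t n) * Real.exp (C₂ * (T.t n * ‖v‖)) := by ring_nf
        _ ≤ _ := by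
          gcongr
          · have : 0 ≤ (C₁ ^ 2 + C₁) + 1 / lam ^ 2 * (1 + Cμ) := by positivity
            linarith
          · linarith)
    (by
      -- The tail condition is now used at `2 t_n`, with `μ(2 t_n) ≤ 1`: the second component
      -- changes the second moment only by a constant factor relative to `M₁(2 t_n)`.
      filter_upwards [ht0, ht2.eventually hbound, ht2.eventually (hμ₀.eventually_le_const one_pos)]
        with n hn hbn hμ1 v
      have hn0 : 0 ≤ T.t n := by linarith
      have hn2 : 0 ≤ 2 * T.t n := by linarith
      have h1 := hM₁ _ hn0
      have h1' := hM₁ _ hn2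
      have h2' := hM₂ _ hn2
      have hnorm : ∀ z, ‖w n z‖ₑ ^ 2 = ENNReal.ofReal (Real.exp (2 * T.t n * z) / c n ^ 2) :=
        fun z => by
          rw [← ofReal_norm, ← ENNReal.ofReal_pow (norm_nonneg _)]
          simp only [w, norm_div, Complex.norm_real, Real.norm_eq_abs, Real.abs_exp, div_pow,
            sq_abs]
          rw [← Real.exp_nat_mul]
          congr 3
          push_cast; ring
      simp only [hnorm]
      have hval : ∀ (F : Measure ℝ) (a : ℝ), Integrable (fun e => Real.exp (2 * T.t n * e)) F →
          ∫⁻ e, ENNReal.ofReal (Real.exp (2 * T.t n * (a + e)) / c n ^ 2) ∂F ≤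
            ENNReal.ofReal (Real.exp (2 * T.t n * a) * mgf id F (2 * T.t n) / c n ^ 2) :=
        fun F a hF => by
          rw [← ofReal_integral_eq_lintegral_ofReal ((integrable_exp_add hF a).div_const _)
            (ae_of_all _ fun e => by positivity), integral_div, integral_exp_add]
      refine (lintegral_shiftMixture_le hlam (by fun_prop) (by positivity) (by positivity)
        (hval _ _ (hmgf₁ _ hn2)) (hval _ _ (hmgf₂ _ hn2))).trans (ENNReal.ofReal_le_ofReal ?_)
      rw [hsplit _ (m₁ (x + v)) (m₁ x), hsplit _ (m₂ (x + v)) (m₁ x)]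
      have hc2 : c n ^ 2 =
          lam ^ 2 * mgf id F₁ (T.t n) ^ 2 * Real.exp (2 * T.t n * m₁ x) := by
        simp only [hc]
        rw [mul_pow, mul_pow, ← Real.exp_nat_mul]
        push_cast; ring_nf
      have he := Real.exp_pos (2 * T.t n * m₁ x)
      have hE : ∀ C, C ≤ C₁ + C₂ → Real.exp (2 * T.t n * (C * ‖v‖)) ≤
          Real.exp (2 * (C₁ + C₂) * (T.t n * ‖v‖)) := fun C hC => by
        refine Real.exp_le_exp.2 ?_
        calc 2 * T.t n * (C * ‖v‖) = 2 * C * (T.t n * ‖v‖) := by ring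
          _ ≤ _ := by gcongr
      calc _ = 1 / lam ^ 2 * V n * (lam * Real.exp (2 * T.t n * (m₁ (x + v) - m₁ x)) +
            (1 - lam) * (mgf id F₂ (2 * T.t n) / mgf id F₁ (2 * T.t n) *
              Real.exp (2 * T.t n * (m₂ (x + v) - m₁ x)))) := by
            rw [hc2]; simp only [V]; field_simp
        _ ≤ 1 / lam ^ 2 * V n * (1 * Real.exp (2 * T.t n * (C₁ * ‖v‖)) +
            1 * (mgf id F₂ (2 * T.t n) / mgf id F₁ (2 * T.t n) *
              (Real.exp (η * (2 * T.t n)) * Real.exp (2 * T.t n * (C₂ * ‖v‖))))) := by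
            gcongr 1 / lam ^ 2 * V n * (?_ * ?_ + ?_ * (_ * ?_))
            · exact hlam.2.le
            · exact hgrow₁ _ hn2 v
            · linarith
            · exact hgrow _ hn2 v
        _ = 1 / lam ^ 2 * V n * (Real.exp (2 * T.t n * (C₁ * ‖v‖)) +
            (Real.exp (η * (2 * T.t n)) * (mgf id F₂ (2 * T.t n) / mgf id F₁ (2 * T.t n))) *
              Real.exp (2 * T.t n * (C₂ * ‖v‖))) := by ring
        _ ≤ 1 / lam ^ 2 * V n * (Real.exp (2 * (C₁ + C₂) * (T.t n * ‖v‖)) +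
            Cμ * Real.exp (2 * (C₁ + C₂) * (T.t n * ‖v‖))) := by
            gcongr 1 / lam ^ 2 * V n * (?_ + ?_ * ?_)
            · exact hE _ (by linarith)
            · refine hbn.trans ?_
              nlinarith
            · exact hE _ (by linarith)
        _ = (1 / lam ^ 2 * (1 + Cμ)) * V n * Real.exp (2 * (C₁ + C₂) * (T.t n * ‖v‖)) := by ring
        _ ≤ _ := by
            gcongr
            have : 0 ≤ (C₁ ^ 2 + C₁) + (1 - lam) / lam * Cμ := by positivity
            linarith)
    hr
  refine hmain.of_le fun n ω => ?_
  simp only [w]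
  rw [nadarayaWatson_div_const, hatMgf, ofReal_nadarayaWatson]

end Applications

/-! ### Kernel estimators of the first two conditional moments. -/

section Moments

variable {Ω : Type*} [MeasurableSpace Ω] {P : Measure Ω} [IsProbabilityMeasure P] {k : ℕ}
  {X : ℕ → Ω → Cov k} {Z : ℕ → Ω → ℝ} {fX : Cov k → ℝ} {lam : ℝ} {F₁ F₂ : Measure ℝ}
  [IsProbabilityMeasure F₁] [IsProbabilityMeasure F₂] {m₁ m₂ : Cov k → ℝ}

theorem lintegral_enorm_pow_add_le {F : Measure ℝ} [IsProbabilityMeasure F] {j : ℕ} (hj : j ≠ 0)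
    (hF : MemLp id ((2 * j : ℕ) : ENNReal) F) :
    ∃ D : ℝ, 0 ≤ D ∧ ∀ a : ℝ, ∫⁻ e, ‖((a + e : ℝ) : ℂ) ^ j‖ₑ ^ 2 ∂F ≤
      ENNReal.ofReal (D * (1 + |a| ^ (2 * j))) := by
  have hint : Integrable (fun e : ℝ => |e| ^ (2 * j)) F := by
    simpa using hF.integrable_norm_pow (by positivity)
  have hI : 0 ≤ ∫ e, |e| ^ (2 * j) ∂F := integral_nonneg fun e => by positivity
  refine ⟨2 ^ (2 * j - 1) * (1 + ∫ e, |e| ^ (2 * j) ∂F), by positivity, fun a => ?_⟩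
  calc ∫⁻ e, ‖((a + e : ℝ) : ℂ) ^ j‖ₑ ^ 2 ∂F
      ≤ ∫⁻ e, ENNReal.ofReal (2 ^ (2 * j - 1) * (|a| ^ (2 * j) + |e| ^ (2 * j))) ∂F := by
        refine lintegral_mono fun e => ?_
        rw [← ofReal_norm, ← ENNReal.ofReal_pow (norm_nonneg _), norm_pow, ← pow_mul,
          Complex.norm_real, Real.norm_eq_abs, mul_comm j 2]
        refine ENNReal.ofReal_le_ofReal ?_
        exact (pow_le_pow_left₀ (abs_nonneg _) (abs_add_le a e) _).trans
          (add_pow_le (abs_nonneg _) (abs_nonneg _) _)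
    _ = ENNReal.ofReal (2 ^ (2 * j - 1) * (|a| ^ (2 * j) + ∫ e, |e| ^ (2 * j) ∂F)) := by
        have hint' : Integrable (fun e : ℝ => |a| ^ (2 * j) + |e| ^ (2 * j)) F :=
          (integrable_const _).add hint
        rw [← ofReal_integral_eq_lintegral_ofReal
          (hint'.const_mul _) (ae_of_all _ fun e => by positivity),
          integral_const_mul, integral_add (integrable_const _) hint]
        simp
    _ ≤ _ := by
        refine ENNReal.ofReal_le_ofReal ?_
        rw [mul_assoc]
        gcongr
        have : 0 ≤ |a| ^ (2 * j) := by positivity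
        nlinarith

/-- A Lipschitz `m` grows at most linearly; bounding its powers by an exponential brings the second
moments of `Z ^ j` to the form required by `nadarayaWatson_rate`. -/
theorem one_add_abs_pow_le {m : Cov k → ℝ} {C : ℝ} (hC : 0 ≤ C)
    (hlip : ∀ x y, |m y - m x| ≤ C * ‖y - x‖) (x v : Cov k) (j : ℕ) :
    1 + |m (x + v)| ^ j ≤ (1 + (|m x| + C) ^ j) * Real.exp (j * ‖v‖) := by
  have h1 : |m (x + v)| ≤ (|m x| + C) * Real.exp ‖v‖ := by
    have h2 := hlip x (x + v)
    rw [add_sub_cancel_left] at h2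
    have h3 := abs_sub_abs_le_abs_sub (m (x + v)) (m x)
    have h4 : ‖v‖ ≤ Real.exp ‖v‖ := by linarith [Real.add_one_le_exp ‖v‖]
    have h5 : 1 ≤ Real.exp ‖v‖ := Real.one_le_exp (norm_nonneg _)
    have h6 : C * ‖v‖ ≤ C * Real.exp ‖v‖ := by gcongr
    have h7 : |m x| * 1 ≤ |m x| * Real.exp ‖v‖ := by gcongr
    linarith
  have h2 : |m (x + v)| ^ j ≤ (|m x| + C) ^ j * Real.exp (j * ‖v‖) := by
    rw [Real.exp_nat_mul, ← mul_pow]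
    exact pow_le_pow_left₀ (abs_nonneg _) h1 _
  have h3 : 1 ≤ Real.exp (j * ‖v‖) := Real.one_le_exp (by positivity)
  linarith

/-- With `N = n^{-1/(k+4)}` one has `n N^k N^4 = 1`, so a bandwidth of exact order `N` balances
squared bias and variance at `N^4`. The upper bound on `d` controls the bias, the lower bound the
variance. -/
theorem nwRate_moment_le {d : ℕ → ℝ} (hd : ∀ n, 0 < d n)
    (hd₀ : d =Θ[atTop] fun n : ℕ => (n : ℝ) ^ (-(1 : ℝ) / (k + 4))) :
    ∃ C : ℝ, 0 ≤ C ∧ ∀ᶠ n in atTop, nwRate k d (fun _ => 1) (fun _ => 0) (fun _ => 1) n ≤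
      C * (n : ℝ) ^ (-(2 : ℝ) / (k + 4)) := by
  obtain ⟨c₂, hc₂, hO⟩ := hd₀.1.exists_pos
  obtain ⟨c₁, hc₁, hO'⟩ := hd₀.2.exists_pos
  refine ⟨√(c₂ ^ 4 + c₁ ^ k), Real.sqrt_nonneg _, ?_⟩
  filter_upwards [hO.bound, hO'.bound, eventually_gt_atTop 0] with n h1 h2 hn
  have hn' : (0 : ℝ) < n := by exact_mod_cast hn
  have hdn := hd n
  set N : ℝ := (n : ℝ) ^ (-(1 : ℝ) / (k + 4)) with hN
  have hNpos : 0 < N := Real.rpow_pos_of_pos hn' _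
  have hk4 : (k : ℝ) + 4 ≠ 0 := by positivity
  have hN2 : (n : ℝ) ^ (-(2 : ℝ) / (k + 4)) = N ^ 2 := by
    rw [hN, ← Real.rpow_natCast, ← Real.rpow_mul hn'.le]
    congr 1; push_cast; ring
  have hNk : n * N ^ k * N ^ 4 = 1 := by
    rw [mul_assoc, ← pow_add, hN, ← Real.rpow_natCast, ← Real.rpow_mul hn'.le]
    push_cast
    rw [div_mul_cancel₀ _ hk4, Real.rpow_neg_one, mul_inv_cancel₀ hn'.ne']
  rw [Real.norm_of_nonneg hdn.le, Real.norm_of_nonneg hNpos.le] at h1 h2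
  rw [nwRate, zero_add, one_mul, hN2]
  refine Real.sqrt_le_iff.2 ⟨by positivity, ?_⟩
  rw [mul_pow, Real.sq_sqrt (by positivity), add_mul, ← pow_mul]
  refine add_le_add ?_ ?_
  · calc d n ^ 4 ≤ (c₂ * N) ^ 4 := by gcongr
      _ = _ := by ring
  · rw [div_le_iff₀ (by positivity)]
    calc 1 = n * N ^ k * N ^ 4 := hNk.symm
      _ ≤ n * (c₁ * d n) ^ k * N ^ 4 := by gcongr
      _ = _ := by ring

theorem tendsto_rpow_neg_two_div (k : ℕ) :
    Tendsto (fun n : ℕ => (n : ℝ) ^ (-(2 : ℝ) / (k + 4))) atTop (𝓝 0) := by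
  have := (tendsto_rpow_neg_atTop (show (0 : ℝ) < 2 / (k + 4) by positivity)).comp
    tendsto_natCast_atTop_atTop
  simpa [neg_div, Function.comp_def] using this

theorem tendsto_bandwidth {d : ℕ → ℝ}
    (hd₀ : d =Θ[atTop] fun n : ℕ => (n : ℝ) ^ (-(1 : ℝ) / (k + 4))) : Tendsto d atTop (𝓝 0) := by
  refine hd₀.1.trans_tendsto ?_
  have := (tendsto_rpow_neg_atTop (show (0 : ℝ) < 1 / (k + 4) by positivity)).comp
    tendsto_natCast_atTop_atTop
  simpa [neg_div, Function.comp_def] using this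

theorem QuadApprox.mixture (lam : ℝ) {G H : Cov k → ℂ} {x : Cov k} {ρ C D c : ℝ} (hρ : 0 ≤ ρ)
    (hC : 0 ≤ C) (hD : 0 ≤ D) (hc : 0 ≤ c) (hG : QuadApprox G x ρ C c)
    (hH : QuadApprox H x ρ D c) :
    QuadApprox (fun y => lam * G y + (1 - lam) * H y) x ρ
      (‖(lam : ℂ)‖ * C + ‖(1 - lam : ℂ)‖ * D) (c + 1) := by
  have h1 := (QuadApprox.const (lam : ℂ) x 0 hρ le_rfl).mul hρ le_rfl hC le_rfl hc hG
  have h2 := (QuadApprox.const (1 - lam : ℂ) x 0 hρ le_rfl).mul hρ le_rfl hD le_rfl hc hH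
  simpa using h1.add h2

/-- The kernel estimator of a conditional moment attains the rate `n^(-2/(k+4))`. -/
theorem IsMixtureSample.hatMoment_rate
    (hs : IsMixtureSample P X Z fX lam F₁ F₂ m₁ m₂) (hlam : lam ∈ Set.Ioo (0 : ℝ) 1)
    {L : Cov k → ℝ} (hL : IsKernel L) (hfX : ContDiff ℝ 2 fX) (hfX_bdd : ∃ C, ∀ x, |fX x| ≤ C)
    (hfX' : BoundedDerivs fX) {x : Cov k} (hfx : 0 < fX x) (hm₁ : ContDiff ℝ 2 m₁)
    (hm₁' : BoundedDerivs m₁) (hm₂ : ContDiff ℝ 2 m₂) (hm₂' : BoundedDerivs m₂)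
    (T : Tuning) (hd : ∀ n, 0 < T.d n)
    (hd₀ : T.d =Θ[atTop] fun n : ℕ => (n : ℝ) ^ (-(1 : ℝ) / (k + 4)))
    {j : ℕ} (hj : j ≠ 0) (hF₁ : MemLp id ((2 * j : ℕ) : ENNReal) F₁)
    (hF₂ : MemLp id ((2 * j : ℕ) : ENNReal) F₂) {G : Cov k → ℂ} {C c : ℝ} (hC : 0 ≤ C) (hc : 0 ≤ c)
    (hG : QuadApprox G x 1 C c)
    (hmean : ∀ y, ∫ z, (z : ℂ) ^ j ∂shiftMixture lam F₁ F₂ (m₁ y) (m₂ y) = G y) :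
    StochBdd P (fun n ω => ‖(hatMoment T n (fun p => X p ω) (fun p => Z p ω) L j x : ℂ) - G x‖)
      (fun n : ℕ => (n : ℝ) ^ (-(2 : ℝ) / (k + 4))) := by
  obtain ⟨C₁, hC₁, hlip₁, -, -⟩ := hm₁'.quadApprox hm₁
  obtain ⟨C₂, hC₂, hlip₂, -, -⟩ := hm₂'.quadApprox hm₂
  obtain ⟨D₁, hD₁, hb₁⟩ := lintegral_enorm_pow_add_le hj hF₁
  obtain ⟨D₂, hD₂, hb₂⟩ := lintegral_enorm_pow_add_le hj hF₂
  obtain ⟨R, -, hR⟩ := nwRate_moment_le hd hd₀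
  have hl := hlam.1
  have hl' : 0 < 1 - lam := by linarith [hlam.2]
  have hrate0 : ∀ n, 0 ≤ nwRate k T.d (fun _ => 1) (fun _ => 0) (fun _ => 1) n := fun n =>
    add_nonneg le_rfl (Real.sqrt_nonneg _)
  set B₁ := D₁ * (1 + (|m₁ x| + C₁) ^ (2 * j))
  set B₂ := D₂ * (1 + (|m₂ x| + C₂) ^ (2 * j))
  have hB₁ : 0 ≤ B₁ := by positivity
  have hB₂ : 0 ≤ B₂ := by positivity
  -- Weights and regression function do not depend on `n`, so the scale is `1`, the variance factor
  -- is constant and no component is discarded.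
  have hmain := hs.nadarayaWatson_rate hlam hL hfX hfX_bdd hfX' hfx hd (w := fun _ z => (z : ℂ) ^ j)
    (τ := G x) (Ga := fun _ => G) (Gb := fun _ _ => 0) (ρ := fun _ => 1) (δ := fun _ => 0)
    (V := fun _ => 1) (C := C + (lam * B₁ + (1 - lam) * B₂)) (c := c + (2 * j : ℕ))
    (fun n => by fun_prop) (by positivity) (by positivity) (by simp) (by simp) (by simp)
    (by simpa using tendsto_bandwidth hd₀)
    (Eventually.of_forall fun n y => by rw [hmean, add_zero])
    (Eventually.of_forall fun n => ⟨hG.mono zero_le_one le_rfl hC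
      (le_add_of_nonneg_right (by positivity)) hc (le_add_of_nonneg_right (by positivity)), rfl⟩)
    (Eventually.of_forall fun n => ⟨continuous_const, fun v => by simp⟩)
    (Eventually.of_forall fun n v => by
      refine (lintegral_shiftMixture_le hlam (by fun_prop) (by positivity) (by positivity)
        (hb₁ _) (hb₂ _)).trans (ENNReal.ofReal_le_ofReal ?_)
      have h1 := one_add_abs_pow_le hC₁ hlip₁ x v (2 * j)
      have h2 := one_add_abs_pow_le hC₂ hlip₂ x v (2 * j)
      have h3 : Real.exp ((2 * j : ℕ) * ‖v‖) ≤ Real.exp ((c + (2 * j : ℕ)) * (1 * ‖v‖)) := by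
        refine Real.exp_le_exp.2 ?_
        rw [one_mul]
        gcongr
        linarith
      calc lam * (D₁ * (1 + |m₁ (x + v)| ^ (2 * j))) + (1 - lam) * (D₂ * (1 + |m₂ (x + v)| ^ (2 * j)))
          ≤ lam * (D₁ * ((1 + (|m₁ x| + C₁) ^ (2 * j)) * Real.exp ((2 * j : ℕ) * ‖v‖))) +
            (1 - lam) * (D₂ * ((1 + (|m₂ x| + C₂) ^ (2 * j)) * Real.exp ((2 * j : ℕ) * ‖v‖))) := by
            gcongr
        _ = (lam * B₁ + (1 - lam) * B₂) * 1 * Real.exp ((2 * j : ℕ) * ‖v‖) := by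
            simp only [B₁, B₂]; ring
        _ ≤ _ := by
            gcongr ?_ * _ * ?_
            exact le_add_of_nonneg_left hC)
    (squeeze_zero' (Eventually.of_forall hrate0) hR
      (by simpa using (tendsto_rpow_neg_two_div k).const_mul R))
  refine (hmain.mono_rate (Eventually.of_forall hrate0) hR).of_le fun n ω => ?_
  rw [hatMoment, ofReal_nadarayaWatson]
  simp

theorem IsMixtureSample.hatMoment_one_rate
    (hs : IsMixtureSample P X Z fX lam F₁ F₂ m₁ m₂) (hlam : lam ∈ Set.Ioo (0 : ℝ) 1)
    {L : Cov k → ℝ} (hL : IsKernel L) (hfX : ContDiff ℝ 2 fX) (hfX_bdd : ∃ C, ∀ x, |fX x| ≤ C)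
    (hfX' : BoundedDerivs fX) {x : Cov k} (hfx : 0 < fX x) (hm₁ : ContDiff ℝ 2 m₁)
    (hm₁' : BoundedDerivs m₁) (hm₂ : ContDiff ℝ 2 m₂) (hm₂' : BoundedDerivs m₂)
    (T : Tuning) (hd : ∀ n, 0 < T.d n)
    (hd₀ : T.d =Θ[atTop] fun n : ℕ => (n : ℝ) ^ (-(1 : ℝ) / (k + 4)))
    (hmean₁ : ∫ e, e ∂F₁ = 0) (hmean₂ : ∫ e, e ∂F₂ = 0)
    (hF₁ : MemLp id 2 F₁) (hF₂ : MemLp id 2 F₂) :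
    StochBdd P (fun n ω => ‖(hatMoment T n (fun p => X p ω) (fun p => Z p ω) L 1 x : ℂ) -
      (lam * m₁ x + (1 - lam) * m₂ x)‖) (fun n : ℕ => (n : ℝ) ^ (-(2 : ℝ) / (k + 4))) := by
  obtain ⟨C₁, hC₁, -, -, hq₁⟩ := hm₁'.quadApprox hm₁
  obtain ⟨C₂, hC₂, -, -, hq₂⟩ := hm₂'.quadApprox hm₂
  have hq := QuadApprox.mixture lam zero_le_one hC₁ hC₂ le_rfl (hq₁ x) (hq₂ x)
  have hi₁ : Integrable (fun e : ℝ => e) F₁ := hF₁.integrable (by norm_num)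
  have hi₂ : Integrable (fun e : ℝ => e) F₂ := hF₂.integrable (by norm_num)
  have hval' : ∀ y, ∫ z, (z : ℂ) ^ 1 ∂shiftMixture lam F₁ F₂ (m₁ y) (m₂ y) =
      lam * m₁ y + (1 - lam) * m₂ y := fun y => by
    have hint : ∀ (F : Measure ℝ) [IsProbabilityMeasure F] (a : ℝ), Integrable (fun e : ℝ => e) F →
        Integrable (fun e => ((a + e : ℝ) : ℂ) ^ 1) F := fun F _ a hF => by
      simp only [pow_one]
      exact ((integrable_const a).add hF).ofReal
    have hval : ∀ (F : Measure ℝ) [IsProbabilityMeasure F] (a : ℝ), Integrable (fun e : ℝ => e) F →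
        ∫ e, e ∂F = 0 → ∫ e, ((a + e : ℝ) : ℂ) ^ 1 ∂F = a := fun F _ a hF h0 => by
      simp only [pow_one]
      rw [integral_complex_ofReal, integral_add (integrable_const a) hF, h0]
      simp
    rw [integral_shiftMixture hlam (by fun_prop) (hint _ _ hi₁) (hint _ _ hi₂), hval _ _ hi₁ hmean₁,
      hval _ _ hi₂ hmean₂]
  have key := hs.hatMoment_rate hlam hL hfX hfX_bdd hfX' hfx hm₁ hm₁' hm₂ hm₂' T hd hd₀ one_ne_zero
    (by simpa using hF₁) (by simpa using hF₂) (by positivity) (by norm_num) hq hval'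
  exact key

/-- The error variances enter the limit as constants independent of `x`, so they will cancel between
`x₀` and `x₁`. Fourth moments bound the second moment of the weight `Z ^ 2`. -/
theorem IsMixtureSample.hatMoment_two_rate
    (hs : IsMixtureSample P X Z fX lam F₁ F₂ m₁ m₂) (hlam : lam ∈ Set.Ioo (0 : ℝ) 1)
    {L : Cov k → ℝ} (hL : IsKernel L) (hfX : ContDiff ℝ 2 fX) (hfX_bdd : ∃ C, ∀ x, |fX x| ≤ C)
    (hfX' : BoundedDerivs fX) {x : Cov k} (hfx : 0 < fX x) (hm₁ : ContDiff ℝ 2 m₁)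
    (hm₁' : BoundedDerivs m₁) (hm₂ : ContDiff ℝ 2 m₂) (hm₂' : BoundedDerivs m₂)
    (T : Tuning) (hd : ∀ n, 0 < T.d n)
    (hd₀ : T.d =Θ[atTop] fun n : ℕ => (n : ℝ) ^ (-(1 : ℝ) / (k + 4)))
    (hmean₁ : ∫ e, e ∂F₁ = 0) (hmean₂ : ∫ e, e ∂F₂ = 0)
    (hF₁ : MemLp id 4 F₁) (hF₂ : MemLp id 4 F₂) :
    StochBdd P (fun n ω => ‖(hatMoment T n (fun p => X p ω) (fun p => Z p ω) L 2 x : ℂ) -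
      (lam * ((m₁ x : ℂ) * m₁ x + (∫ e, e ^ 2 ∂F₁ : ℝ)) +
        (1 - lam) * ((m₂ x : ℂ) * m₂ x + (∫ e, e ^ 2 ∂F₂ : ℝ)))‖)
      (fun n : ℕ => (n : ℝ) ^ (-(2 : ℝ) / (k + 4))) := by
  obtain ⟨C₁, hC₁, -, -, hq₁⟩ := hm₁'.quadApprox hm₁
  obtain ⟨C₂, hC₂, -, -, hq₂⟩ := hm₂'.quadApprox hm₂
  have hsq : ∀ (m : Cov k → ℝ) (C v : ℝ), 0 ≤ C → QuadApprox (fun y => (m y : ℂ)) x 1 C 0 →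
      QuadApprox (fun y => (m y : ℂ) * m y + (v : ℂ)) x 1
        (C * C + ‖(m x : ℂ)‖ * C + ‖(m x : ℂ)‖ * C + 0) (0 + 0 + 1) := fun m C v hC hq =>
    (QuadApprox.mul zero_le_one hC hC le_rfl le_rfl hq hq).add
      (QuadApprox.const _ x _ zero_le_one le_rfl)
  have hq := QuadApprox.mixture lam zero_le_one (by positivity) (by positivity) (by norm_num)
    (hsq m₁ C₁ (∫ e, e ^ 2 ∂F₁) hC₁ (hq₁ x)) (hsq m₂ C₂ (∫ e, e ^ 2 ∂F₂) hC₂ (hq₂ x))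
  have hval' : ∀ y, ∫ z, (z : ℂ) ^ 2 ∂shiftMixture lam F₁ F₂ (m₁ y) (m₂ y) =
      lam * ((m₁ y : ℂ) * m₁ y + (∫ e, e ^ 2 ∂F₁ : ℝ)) +
        (1 - lam) * ((m₂ y : ℂ) * m₂ y + (∫ e, e ^ 2 ∂F₂ : ℝ)) := fun y => by
    have hsplit : ∀ a e : ℝ, ((a + e : ℝ) : ℂ) ^ 2 = ((a ^ 2 + 2 * a * e + e ^ 2 : ℝ) : ℂ) :=
      fun a e => by push_cast; ring
    have hF' : ∀ (F : Measure ℝ) [IsProbabilityMeasure F] (a : ℝ), MemLp id 4 F →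
        Integrable (fun e : ℝ => a ^ 2 + 2 * a * e) F ∧ Integrable (fun e : ℝ => e ^ 2) F ∧
          Integrable (fun e : ℝ => e) F := fun F _ a hF => by
      have h2 : MemLp (fun e : ℝ => e) 2 F := hF.mono_exponent (by norm_num)
      have h1 : Integrable (fun e : ℝ => e) F := h2.integrable (by norm_num)
      exact ⟨(integrable_const _).add (h1.const_mul _), h2.integrable_sq, h1⟩
    have hint : ∀ (F : Measure ℝ) [IsProbabilityMeasure F] (a : ℝ), MemLp id 4 F →
        Integrable (fun e => ((a + e : ℝ) : ℂ) ^ 2) F := fun F _ a hF => by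
      simp only [hsplit]
      exact ((hF' F a hF).1.add (hF' F a hF).2.1).ofReal
    have hval : ∀ (F : Measure ℝ) [IsProbabilityMeasure F] (a : ℝ), MemLp id 4 F →
        ∫ e, e ∂F = 0 → ∫ e, ((a + e : ℝ) : ℂ) ^ 2 ∂F = (a : ℂ) * a + (∫ e, e ^ 2 ∂F : ℝ) :=
      fun F _ a hF h0 => by
        obtain ⟨h1, h2, h3⟩ := hF' F a hF
        simp only [hsplit]
        rw [integral_complex_ofReal, integral_add h1 h2,
          integral_add (integrable_const _) (h3.const_mul _), integral_const_mul, h0]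
        simp [pow_two]
    rw [integral_shiftMixture hlam (by fun_prop) (hint _ _ hF₁) (hint _ _ hF₂), hval _ _ hF₁ hmean₁,
      hval _ _ hF₂ hmean₂]
  have key := hs.hatMoment_rate hlam hL hfX hfX_bdd hfX' hfx hm₁ hm₁' hm₂ hm₂' T hd hd₀ two_ne_zero
    (by norm_num; exact hF₁) (by norm_num; exact hF₂) (by positivity) (by norm_num) hq hval'
  exact key

end Moments

/-! ### The two slope estimators. -/

section Slopes

variable {Ω : Type*} [MeasurableSpace Ω] {P : Measure Ω} [IsProbabilityMeasure P] {k : ℕ}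
  {X : ℕ → Ω → Cov k} {Z : ℕ → Ω → ℝ} {fX : Cov k → ℝ} {lam : ℝ} {F₁ F₂ : Measure ℝ}
  [IsProbabilityMeasure F₁] [IsProbabilityMeasure F₂] {m₁ m₂ : Cov k → ℝ}

theorem abs_log_le_two_mul {a : ℝ} (ha : |a - 1| ≤ 1 / 2) : |Real.log a| ≤ 2 * |a - 1| := by
  obtain ⟨h1, h2⟩ := abs_le.1 ha
  have ha0 : 0 < a := by linarith
  have hup := Real.log_le_sub_one_of_pos ha0
  have hlow := Real.one_sub_inv_le_log_of_pos ha0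
  have h3 : 1 - a⁻¹ = (a - 1) / a := by field_simp
  have h4 : -(2 * |a - 1|) ≤ (a - 1) / a := by
    rw [le_div_iff₀ ha0]
    nlinarith [neg_abs_le (a - 1), abs_nonneg (a - 1)]
  refine abs_le.2 ⟨by linarith, ?_⟩
  linarith [le_abs_self (a - 1), abs_nonneg (a - 1)]

/-- The common factor `c` cancels in the ratio. Kernels may be signed, so the positivity of the
estimates is itself a consequence of their relative error being at most `1/2`. -/
theorem abs_log_ratio_sub_le {M₀ M₁ c y₀ y₁ : ℝ} (hc : 0 < c)
    (h₀ : |M₀ / (c * Real.exp y₀) - 1| ≤ 1 / 2) (h₁ : |M₁ / (c * Real.exp y₁) - 1| ≤ 1 / 2) :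
    |Real.log (M₁ / M₀) - (y₁ - y₀)| ≤
      2 * (|M₁ / (c * Real.exp y₁) - 1| + |M₀ / (c * Real.exp y₀) - 1|) := by
  set a₀ := M₀ / (c * Real.exp y₀) with ha₀
  set a₁ := M₁ / (c * Real.exp y₁) with ha₁
  have hp₀ : 0 < a₀ := by linarith [(abs_le.1 h₀).1]
  have hp₁ : 0 < a₁ := by linarith [(abs_le.1 h₁).1]
  have hM₀ : M₀ = a₀ * (c * Real.exp y₀) := by rw [ha₀]; field_simp
  have hM₁ : M₁ = a₁ * (c * Real.exp y₁) := by rw [ha₁]; field_simp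
  have hratio : M₁ / M₀ = a₁ / a₀ * Real.exp (y₁ - y₀) := by
    rw [hM₀, hM₁, Real.exp_sub]
    field_simp
  rw [hratio, Real.log_mul (by positivity) (by positivity), Real.log_exp,
    Real.log_div hp₁.ne' hp₀.ne', add_sub_cancel_right]
  have := abs_sub (Real.log a₁) (Real.log a₀)
  linarith [abs_log_le_two_mul h₀, abs_log_le_two_mul h₁]

theorem IsMixtureSample.hatDelta_rate
    (hs : IsMixtureSample P X Z fX lam F₁ F₂ m₁ m₂) (hlam : lam ∈ Set.Ioo (0 : ℝ) 1)
    {K : Cov k → ℝ} (hK : IsKernel K) (hfX : ContDiff ℝ 2 fX) (hfX_bdd : ∃ C, ∀ x, |fX x| ≤ C)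
    (hfX' : BoundedDerivs fX) {x₀ x₁ : Cov k} (hfX₀ : 0 < fX x₀) (hfX₁ : 0 < fX x₁)
    (hm₁ : ContDiff ℝ 2 m₁) (hm₁' : BoundedDerivs m₁) (hm₂ : ContDiff ℝ 2 m₂)
    (hm₂' : BoundedDerivs m₂) (T : Tuning) (hh : ∀ n, 0 < T.h n)
    (ht : Tendsto T.t atTop atTop) (hth : Tendsto (fun n => T.t n * T.h n) atTop (𝓝 0))
    (hmgf₁ : ∀ t : ℝ, 0 ≤ t → Integrable (fun e => Real.exp (t * e)) F₁)
    (hmgf₂ : ∀ t : ℝ, 0 ≤ t → Integrable (fun e => Real.exp (t * e)) F₂)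
    {μ : ℝ → ℝ} (hμ : ∀ t, 0 ≤ μ t) (hμ₀ : Tendsto μ atTop (𝓝 0))
    (hratio : ∀ η : ℝ, 0 < η →
      (fun t : ℝ => Real.exp (η * t) * (mgf id F₂ t / mgf id F₁ t)) =O[atTop] μ)
    (hα : Tendsto (fun n => mgfVariance k T F₁ n) atTop (𝓝 0)) :
    Tendsto (alphaRate k T F₁ μ) atTop (𝓝 0) ∧
    StochBdd P (fun n ω => ‖(hatDelta K T x₀ x₁ n (fun p => X p ω) (fun p => Z p ω) : ℂ) -
      (m₁ x₁ - m₁ x₀ : ℝ)‖) (alphaRate k T F₁ μ) := by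
  have hr : Tendsto (fun n => μ (T.t n) + √((T.t n * T.h n) ^ 4 + mgfVariance k T F₁ n))
      atTop (𝓝 0) := by
    simpa using (hμ₀.comp ht).add (((hth.pow 4).add hα).sqrt)
  have hrate : (fun n => 1 / T.t n *
      (μ (T.t n) + √((T.t n * T.h n) ^ 4 + mgfVariance k T F₁ n))) = alphaRate k T F₁ μ := by
    ext n
    rw [alphaRate]; ring
  have hinv : Tendsto (fun n => 1 / T.t n) atTop (𝓝 0) := by
    simpa [Function.comp_def] using tendsto_inv_atTop_zero.comp ht
  refine ⟨by rw [← hrate]; simpa using hinv.mul hr, ?_⟩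
  have h₀ := hs.hatMgf_rate hlam hK hfX hfX_bdd hfX' hfX₀ hm₁ hm₁' hm₂ hm₂' T hh ht hth hmgf₁ hmgf₂
    hμ hμ₀ hratio hr
  have h₁ := hs.hatMgf_rate hlam hK hfX hfX_bdd hfX' hfX₁ hm₁ hm₁' hm₂ hm₂' T hh ht hth hmgf₁ hmgf₂
    hμ hμ₀ hratio hr
  rw [← hrate]
  -- The logarithm inherits the relative errors; the division by `t_n` in the estimator is the
  -- factor `1 / t_n` of `alphaRate`.
  refine (h₁.add h₀).transfer hr (δ := 1 / 2) (C := 2) (by norm_num) (by norm_num)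
    (by filter_upwards [ht.eventually_gt_atTop 0] with n hn; positivity) ?_
  filter_upwards [ht.eventually_gt_atTop 0] with n hn ω hω
  have hM : 0 < lam * mgf id F₁ (T.t n) := mul_pos hlam.1 (mgf_pos (hmgf₁ _ hn.le))
  simp only [← Complex.ofReal_div, ← Complex.ofReal_one, ← Complex.ofReal_sub, Complex.norm_real,
    Real.norm_eq_abs] at hω ⊢
  have hlog := abs_log_ratio_sub_le hM ((le_add_of_nonneg_left (abs_nonneg _)).trans hω)
    ((le_add_of_nonneg_right (abs_nonneg _)).trans hω)
  set R := |hatMgf K T n (fun p => X p ω) (fun p => Z p ω) x₁ (T.t n) /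
      (lam * mgf id F₁ (T.t n) * Real.exp (T.t n * m₁ x₁)) - 1| +
    |hatMgf K T n (fun p => X p ω) (fun p => Z p ω) x₀ (T.t n) /
      (lam * mgf id F₁ (T.t n) * Real.exp (T.t n * m₁ x₀)) - 1|
  have heq : hatDelta K T x₀ x₁ n (fun p => X p ω) (fun p => Z p ω) - (m₁ x₁ - m₁ x₀) =
      1 / T.t n * (Real.log (hatMgf K T n (fun p => X p ω) (fun p => Z p ω) x₁ (T.t n) /
        hatMgf K T n (fun p => X p ω) (fun p => Z p ω) x₀ (T.t n)) -
          (T.t n * m₁ x₁ - T.t n * m₁ x₀)) := by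
    rw [hatDelta]; field_simp
  rw [heq, abs_mul, abs_of_pos (by positivity)]
  calc _ ≤ 1 / T.t n * (2 * R) := by gcongr
    _ = _ := by ring

theorem exp_log_of_norm_sub_one_le {z : ℂ} (hz : ‖z - 1‖ ≤ 1 / 4) :
    Complex.exp (Complex.log z) = z ∧ ‖Complex.log z‖ ≤ 3 / 2 * ‖z - 1‖ := by
  refine ⟨Complex.exp_log ?_, ?_⟩
  · rintro rfl
    norm_num at hz
  · have := Complex.norm_log_one_add_half_le_self (z := z - 1) (by linarith)
    rwa [add_sub_cancel] at this

/-- Each normalized estimate is the exponential of a small logarithm and `c`, `c'` cancel, so the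
cross ratio is `exp(Λ + i(s' - s)(y₁ - y₀))` with `Λ` small. Its exponent lies in the strip where
the principal logarithm inverts `exp`, so no multiple of `2πi` intervenes. -/
theorem norm_log_cross_ratio_sub_le {a₀ a₁ a₀' a₁' c c' : ℂ} (hc : c ≠ 0) (hc' : c' ≠ 0)
    {s s' y₀ y₁ : ℝ} (hs : |(s' - s) * (y₁ - y₀)| ≤ 1)
    (h : ‖a₁' / (c' * Complex.exp (Complex.I * s' * y₁)) - 1‖ +
      ‖a₀' / (c' * Complex.exp (Complex.I * s' * y₀)) - 1‖ +
      (‖a₁ / (c * Complex.exp (Complex.I * s * y₁)) - 1‖ +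
      ‖a₀ / (c * Complex.exp (Complex.I * s * y₀)) - 1‖) ≤ 1 / 4) :
    ‖Complex.log (a₁' / a₀' * (a₁ / a₀)⁻¹) - Complex.I * ((s' - s) * (y₁ - y₀) : ℝ)‖ ≤
      3 / 2 * (‖a₁' / (c' * Complex.exp (Complex.I * s' * y₁)) - 1‖ +
      ‖a₀' / (c' * Complex.exp (Complex.I * s' * y₀)) - 1‖ +
      (‖a₁ / (c * Complex.exp (Complex.I * s * y₁)) - 1‖ +
      ‖a₀ / (c * Complex.exp (Complex.I * s * y₀)) - 1‖)) := by
  set b₁' := a₁' / (c' * Complex.exp (Complex.I * s' * y₁)) with hb₁'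
  set b₀' := a₀' / (c' * Complex.exp (Complex.I * s' * y₀)) with hb₀'
  set b₁ := a₁ / (c * Complex.exp (Complex.I * s * y₁)) with hb₁
  set b₀ := a₀ / (c * Complex.exp (Complex.I * s * y₀)) with hb₀
  have n1 := norm_nonneg (b₁' - 1)
  have n2 := norm_nonneg (b₀' - 1)
  have n3 := norm_nonneg (b₁ - 1)
  have n4 := norm_nonneg (b₀ - 1)
  obtain ⟨e1, l1⟩ := exp_log_of_norm_sub_one_le (z := b₁') (by linarith)
  obtain ⟨e2, l2⟩ := exp_log_of_norm_sub_one_le (z := b₀') (by linarith)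
  obtain ⟨e3, l3⟩ := exp_log_of_norm_sub_one_le (z := b₁) (by linarith)
  obtain ⟨e4, l4⟩ := exp_log_of_norm_sub_one_le (z := b₀) (by linarith)
  set Λ := Complex.log b₁' - Complex.log b₀' - (Complex.log b₁ - Complex.log b₀) with hΛ
  have hΛ' : ‖Λ‖ ≤ 3 / 2 * (‖b₁' - 1‖ + ‖b₀' - 1‖ + (‖b₁ - 1‖ + ‖b₀ - 1‖)) := by
    have h1 := norm_sub_le (Complex.log b₁' - Complex.log b₀') (Complex.log b₁ - Complex.log b₀)
    have h2 := norm_sub_le (Complex.log b₁') (Complex.log b₀')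
    have h3 := norm_sub_le (Complex.log b₁) (Complex.log b₀)
    linarith
  have hratio : a₁' / a₀' * (a₁ / a₀)⁻¹ =
      Complex.exp (Λ + Complex.I * ((s' - s) * (y₁ - y₀) : ℝ)) := by
    have ha : ∀ {a b d u : ℂ}, d ≠ 0 → b = a / (d * Complex.exp u) →
        Complex.exp (Complex.log b) = b → a = d * Complex.exp (u + Complex.log b) := by
      intro a b d u hd hb he
      rw [Complex.exp_add, he, hb]
      field_simp [Complex.exp_ne_zero]
    rw [ha hc' hb₁' e1, ha hc' hb₀' e2, ha hc hb₁ e3, ha hc hb₀ e4,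
      mul_div_mul_left _ _ hc', mul_div_mul_left _ _ hc, ← Complex.exp_sub, ← Complex.exp_sub,
      ← Complex.exp_neg, ← Complex.exp_add, hΛ]
    congr 1
    push_cast
    ring
  -- `‖Λ‖ ≤ 3/8` and the phase is at most `1`, well below `π`.
  have him : |(Λ + Complex.I * ((s' - s) * (y₁ - y₀) : ℝ)).im| ≤ 3 / 2 := by
    have h1 := Complex.abs_im_le_norm Λ
    have h2 : (Λ + Complex.I * ((s' - s) * (y₁ - y₀) : ℝ)).im =
        Λ.im + (s' - s) * (y₁ - y₀) := by simp
    rw [h2]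
    have := abs_add_le Λ.im ((s' - s) * (y₁ - y₀))
    linarith
  have hpi := Real.pi_gt_three
  rw [hratio, Complex.log_exp (by linarith [(abs_le.1 him).1]) (by linarith [(abs_le.1 him).2]),
    add_sub_cancel_right]
  exact hΛ'

theorem IsMixtureSample.hatNabla_rate
    (hs : IsMixtureSample P X Z fX lam F₁ F₂ m₁ m₂) (hlam : lam ∈ Set.Ioo (0 : ℝ) 1)
    {K : Cov k → ℝ} (hK : IsKernel K) (hfX : ContDiff ℝ 2 fX) (hfX_bdd : ∃ C, ∀ x, |fX x| ≤ C)
    (hfX' : BoundedDerivs fX) {x₀ x₁ : Cov k} (hfX₀ : 0 < fX x₀) (hfX₁ : 0 < fX x₁)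
    (hm₁ : ContDiff ℝ 2 m₁) (hm₂ : ContDiff ℝ 2 m₂)
    (hm₂' : BoundedDerivs m₂) (T : Tuning) (hb : ∀ n, 0 < T.b n)
    (hs₀ : Tendsto T.s atTop atTop) (hsb : Tendsto (fun n => T.s n * T.b n) atTop (𝓝 0))
    (ha : ∀ n, T.a n ≠ 0) (ha₀ : Tendsto T.a atTop (𝓝 0))
    {f : ℝ → ℝ} (hf : ∀ s, 0 ≤ f s)
    (hφ₂ : ∀ᶠ s : ℝ in atTop, charFun F₂ s ≠ 0)
    (hφ : (fun s : ℝ => charFun F₁ s / charFun F₂ s) =O[atTop] f)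
    (hβ : Tendsto (fun n => betaRate k T F₂ f n) atTop (𝓝 0)) :
    StochBdd P (fun n ω => ‖hatNabla K T x₀ x₁ n (fun p => X p ω) (fun p => Z p ω) -
      (m₂ x₁ - m₂ x₀ : ℝ)‖) (betaRate k T F₂ f) := by
  -- The sum of the relative errors before division by `|a_n|`. It equals `|a_n|` times `betaRate`,
  -- so it vanishes as well.
  set r : ℕ → ℝ := fun n => f (T.s n + T.a n) + f (T.s n)
    + cfError k T F₂ n (T.s n + T.a n) + cfError k T F₂ n (T.s n) with hrdef
  have hrβ : (fun n => 1 / |T.a n| * r n) = betaRate k T F₂ f := rfl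
  have hr : Tendsto r atTop (𝓝 0) := by
    have h1 : r = fun n => |T.a n| * betaRate k T F₂ f n := by
      ext n
      rw [← hrβ]
      have := abs_pos.2 (ha n)
      field_simp
    rw [h1]
    simpa using ha₀.abs.mul hβ
  have hle : ∀ n, f (T.s n) + cfError k T F₂ n (T.s n) ≤ r n := fun n => by
    have h1 := hf (T.s n + T.a n)
    have h2 := cfError_nonneg (k := k) T F₂ n (T.s n + T.a n)
    simp only [hrdef]; linarith
  have hle' : ∀ n, f (T.s n + T.a n) + cfError k T F₂ n (T.s n + T.a n) ≤ r n := fun n => by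
    have h1 := hf (T.s n)
    have h2 := cfError_nonneg (k := k) T F₂ n (T.s n)
    simp only [hrdef]; linarith
  have hnn : ∀ n s, 0 ≤ f s + cfError k T F₂ n s := fun n s =>
    add_nonneg (hf s) (cfError_nonneg T F₂ n s)
  have hs' : Tendsto (fun n => T.s n + T.a n) atTop atTop := hs₀.atTop_add ha₀
  have hσ : ∀ᶠ n in atTop, |T.s n| ≤ 2 * T.s n := by
    filter_upwards [hs₀.eventually_ge_atTop 0] with n hn
    rw [abs_of_nonneg hn]; linarith
  have hσ' : ∀ᶠ n in atTop, |T.s n + T.a n| ≤ 2 * T.s n := by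
    have h1 : ∀ᶠ n in atTop, |T.a n| ≤ 1 := by
      have := ha₀.abs
      rw [abs_zero] at this
      exact this.eventually_le_const one_pos
    filter_upwards [hs₀.eventually_ge_atTop 1, h1] with n hn hn'
    have h2 := abs_add_le (T.s n) (T.a n)
    rw [abs_of_nonneg (show 0 ≤ T.s n by linarith)] at h2
    linarith
  have hcf : ∀ {x : Cov k}, 0 < fX x → StochBdd P (fun n ω =>
      ‖hatCf K T n (fun p => X p ω) (fun p => Z p ω) x (T.s n) /
        ((1 - lam) * charFun F₂ (T.s n) * Complex.exp (Complex.I * T.s n * m₂ x)) - 1‖) r :=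
    fun hx => (hs.hatCf_rate hlam hK hfX hfX_bdd hfX' hx hm₁ hm₂ hm₂' T hb hs₀ hsb hs₀ hσ hf hφ₂ hφ
      (squeeze_zero (fun n => hnn n _) hle hr)).mono_rate (c := 1)
      (Eventually.of_forall fun n => hnn n _) (Eventually.of_forall fun n => by simpa using hle n)
  have hcf' : ∀ {x : Cov k}, 0 < fX x → StochBdd P (fun n ω =>
      ‖hatCf K T n (fun p => X p ω) (fun p => Z p ω) x (T.s n + T.a n) /
        ((1 - lam) * charFun F₂ (T.s n + T.a n) *
          Complex.exp (Complex.I * (T.s n + T.a n : ℝ) * m₂ x)) - 1‖) r :=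
    fun hx => (hs.hatCf_rate hlam hK hfX hfX_bdd hfX' hx hm₁ hm₂ hm₂' T hb hs₀ hsb hs' hσ' hf hφ₂ hφ
      (squeeze_zero (fun n => hnn n _) hle' hr)).mono_rate (c := 1)
      (Eventually.of_forall fun n => hnn n _) (Eventually.of_forall fun n => by simpa using hle' n)
  have hlc : (1 - (lam : ℂ)) ≠ 0 := by
    exact_mod_cast (show 0 < 1 - lam by linarith [hlam.2]).ne'
  -- This is where `a_n → 0` removes the ambiguity of the logarithm.
  have hsmall : ∀ᶠ n in atTop, |T.a n * (m₂ x₁ - m₂ x₀)| ≤ 1 := by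
    have := (ha₀.mul_const (m₂ x₁ - m₂ x₀)).abs
    rw [zero_mul, abs_zero] at this
    exact this.eventually_le_const one_pos
  rw [← hrβ]
  refine (((hcf' hfX₁).add (hcf' hfX₀)).add ((hcf hfX₁).add (hcf hfX₀))).transfer hr (δ := 1 / 4)
    (C := 3 / 2) (by norm_num) (by norm_num) (Eventually.of_forall fun n => by positivity) ?_
  filter_upwards [hs₀.eventually hφ₂, hs'.eventually hφ₂, hsmall] with n h1 h2 h3 ω hω
  have hlog := norm_log_cross_ratio_sub_le (mul_ne_zero hlc h1) (mul_ne_zero hlc h2)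
    (s := T.s n) (s' := T.s n + T.a n) (by rwa [add_sub_cancel_left]) hω
  rw [add_sub_cancel_left] at hlog
  have hac : (T.a n : ℂ) ≠ 0 := by exact_mod_cast ha n
  have heq : ∀ q : ℂ, -Complex.I / (T.a n : ℂ) * q - ((m₂ x₁ - m₂ x₀ : ℝ) : ℂ) =
      -Complex.I / (T.a n : ℂ) * (q - Complex.I * (T.a n * (m₂ x₁ - m₂ x₀) : ℝ)) := fun q => by
    push_cast
    field_simp
    linear_combination (-((T.a n : ℂ) * (m₂ x₁ - m₂ x₀))) * Complex.I_mul_I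
  rw [hatNabla, heq, norm_mul, norm_div, norm_neg, Complex.norm_I, Complex.norm_real,
    Real.norm_eq_abs]
  calc _ ≤ 1 / |T.a n| * _ := mul_le_mul_of_nonneg_left hlog (by positivity)
    _ = _ := by ring

end Slopes

/-! ### Explicit solution of the linear system. -/

section PlugIn

/-- Cramer's rule, with determinant `∇̂ - Δ̂`. Thanks to the convention for inverses of zero no
nondegeneracy is required. -/
theorem hatM_zero {k : ℕ} (K : Cov k → ℝ) (T : Tuning) (x₀ x₁ : Cov k) (n : ℕ)
    (X : ℕ → Cov k) (Z : ℕ → ℝ) (L : Cov k → ℝ) :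
    hatM K T x₀ x₁ n X Z L 0 = (hatLambda K T x₀ x₁ n X Z L)⁻¹ *
      ((hatNabla K T x₀ x₁ n X Z - hatDelta K T x₀ x₁ n X Z)⁻¹ *
        (hatC K T x₀ x₁ n X Z L + hatNabla K T x₀ x₁ n X Z * hatMoment T n X Z L 1 x₀)) := by
  simp [hatM, Matrix.inv_def, Matrix.adjugate_fin_two, Matrix.det_fin_two, Matrix.mulVec,
    Matrix.mul_apply, dotProduct, Fin.sum_univ_two]
  ring

theorem hatM_one {k : ℕ} (K : Cov k → ℝ) (T : Tuning) (x₀ x₁ : Cov k) (n : ℕ)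
    (X : ℕ → Cov k) (Z : ℕ → ℝ) (L : Cov k → ℝ) :
    hatM K T x₀ x₁ n X Z L 1 = (1 - hatLambda K T x₀ x₁ n X Z L)⁻¹ *
      ((hatNabla K T x₀ x₁ n X Z - hatDelta K T x₀ x₁ n X Z)⁻¹ *
        (-hatC K T x₀ x₁ n X Z L - hatDelta K T x₀ x₁ n X Z * hatMoment T n X Z L 1 x₀)) := by
  simp [hatM, Matrix.inv_def, Matrix.adjugate_fin_two, Matrix.det_fin_two, Matrix.mulVec,
    Matrix.mul_apply, dotProduct, Fin.sum_univ_two]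
  ring

end PlugIn

/-! ### Delta method for plug-in formulas. -/

section EstimatorCalculus

variable {Ω : Type*} [MeasurableSpace Ω] {P : Measure Ω} {ε : ℕ → ℝ} {A B : ℕ → Ω → ℂ} {a b : ℂ}

/-- `A n` estimates `a` with an error `O_P(ε n)`. -/
def EstimatesAt (P : Measure Ω) (ε : ℕ → ℝ) (A : ℕ → Ω → ℂ) (a : ℂ) : Prop :=
  StochBdd P (fun n ω => ‖A n ω - a‖) ε

theorem EstimatesAt.add (hA : EstimatesAt P ε A a) (hB : EstimatesAt P ε B b) :
    EstimatesAt P ε (fun n ω => A n ω + B n ω) (a + b) := by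
  refine (StochBdd.add hA hB).of_le fun n ω => ?_
  rw [add_sub_add_comm]
  exact norm_add_le _ _

theorem EstimatesAt.neg (hA : EstimatesAt P ε A a) :
    EstimatesAt P ε (fun n ω => -A n ω) (-a) := by
  refine StochBdd.of_le hA fun n ω => ?_
  rw [neg_sub_neg, norm_sub_rev]

theorem EstimatesAt.sub (hA : EstimatesAt P ε A a) (hB : EstimatesAt P ε B b) :
    EstimatesAt P ε (fun n ω => A n ω - B n ω) (a - b) := by
  simpa only [sub_eq_add_neg] using hA.add hB.neg

theorem EstimatesAt.comp (hA : EstimatesAt P ε A a) (hε : Tendsto ε atTop (𝓝 0)) {g : ℂ → ℂ}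
    (hg : DifferentiableAt ℂ g a) : EstimatesAt P ε (fun n ω => g (A n ω)) (g a) :=
  StochBdd.comp_differentiableAt hA hε hg

theorem EstimatesAt.mul (hA : EstimatesAt P ε A a) (hB : EstimatesAt P ε B b)
    (hε : Tendsto ε atTop (𝓝 0)) : EstimatesAt P ε (fun n ω => A n ω * B n ω) (a * b) := by
  -- Where the two errors sum to at most `1`, their product is bounded by a single error, so the
  -- whole bound is linear.
  refine (StochBdd.add hA hB).transfer' hε (δ := 1) (C := 1 + ‖a‖ + ‖b‖) one_pos (by positivity)
    (Eventually.of_forall fun n ω hω => ?_)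
  have h1 := norm_nonneg (A n ω - a)
  have h2 := norm_nonneg (B n ω - b)
  have h3 := norm_nonneg a
  have h4 := norm_nonneg b
  calc ‖A n ω * B n ω - a * b‖
      = ‖(A n ω - a) * (B n ω - b) + a * (B n ω - b) + b * (A n ω - a)‖ := by ring_nf
    _ ≤ ‖A n ω - a‖ * ‖B n ω - b‖ + ‖a‖ * ‖B n ω - b‖ + ‖b‖ * ‖A n ω - a‖ := by
        simp only [← norm_mul]; exact norm_add₃_le
    _ ≤ (1 + ‖a‖ + ‖b‖) * (‖A n ω - a‖ + ‖B n ω - b‖) := by nlinarith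

theorem EstimatesAt.inv (hA : EstimatesAt P ε A a) (hε : Tendsto ε atTop (𝓝 0)) (ha : a ≠ 0) :
    EstimatesAt P ε (fun n ω => (A n ω)⁻¹) a⁻¹ :=
  hA.comp hε (differentiableAt_inv ha)

end EstimatorCalculus

end MixRate

end

/-! ### The main theorem. -/

theorem mainTheorem9 {Ω : Type*} [MeasurableSpace Ω] (P : Measure Ω) [IsProbabilityMeasure P]
    {k : ℕ} (X : ℕ → Ω → MixRate.Cov k) (Z : ℕ → Ω → ℝ) (fX : MixRate.Cov k → ℝ)
    (lam : ℝ) (hlam : lam ∈ Set.Ioo (0 : ℝ) 1)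
    (F₁ F₂ : Measure ℝ) [IsProbabilityMeasure F₁] [IsProbabilityMeasure F₂]
    (m₁ m₂ : MixRate.Cov k → ℝ) (x₀ x₁ : MixRate.Cov k)
    -- the sampling model
    (hsample : MixRate.IsMixtureSample P X Z fX lam F₁ F₂ m₁ m₂)
    (hmean₁ : ∫ e, e ∂F₁ = 0) (hmean₂ : ∫ e, e ∂F₂ = 0)
    (hvar₁ : MemLp id 2 F₁) (hvar₂ : MemLp id 2 F₂)
    -- the two regression functions are not parallel between the two points
    (hslope : m₁ x₁ - m₁ x₀ ≠ m₂ x₁ - m₂ x₀)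
    -- the kernels: `K` for the slopes, `L` for the conditional moments
    (K L : MixRate.Cov k → ℝ) (hK : MixRate.IsKernel K) (hL : MixRate.IsKernel L)
    -- smoothness
    (hfX : ContDiff ℝ 2 fX) (hfX_bdd : ∃ C, ∀ x, |fX x| ≤ C) (hfX' : MixRate.BoundedDerivs fX)
    (hfX₀ : 0 < fX x₀) (hfX₁ : 0 < fX x₁)
    (hm₁ : ContDiff ℝ 2 m₁) (hm₁' : MixRate.BoundedDerivs m₁)
    (hm₂ : ContDiff ℝ 2 m₂) (hm₂' : MixRate.BoundedDerivs m₂)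
    -- bandwidths and tuning parameters
    (T : MixRate.Tuning)
    (hh : ∀ n, 0 < T.h n) (hh₀ : Tendsto T.h atTop (𝓝 0))
    (hh₁ : Tendsto (fun n : ℕ => (n : ℝ) * T.h n ^ k) atTop atTop)
    (hb : ∀ n, 0 < T.b n) (hb₀ : Tendsto T.b atTop (𝓝 0))
    (hb₁ : Tendsto (fun n : ℕ => (n : ℝ) * T.b n ^ k) atTop atTop)
    (hd : ∀ n, 0 < T.d n)
    (hd₀ : T.d =Θ[atTop] fun n : ℕ => (n : ℝ) ^ (-(1 : ℝ) / (k + 4)))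
    (ht : Tendsto T.t atTop atTop) (hth : Tendsto (fun n => T.t n * T.h n) atTop (𝓝 0))
    (hs : Tendsto T.s atTop atTop) (hsb : Tendsto (fun n => T.s n * T.b n) atTop (𝓝 0))
    (ha : ∀ n, T.a n ≠ 0) (ha₀ : Tendsto T.a atTop (𝓝 0))
    -- tails of the moment generating and characteristic functions
    (hmgf₁ : ∀ t : ℝ, 0 ≤ t → Integrable (fun e => Real.exp (t * e)) F₁)
    (hmgf₂ : ∀ t : ℝ, 0 ≤ t → Integrable (fun e => Real.exp (t * e)) F₂)
    (μ : ℝ → ℝ) (hμ : ∀ t, 0 ≤ μ t) (hμ₀ : Tendsto μ atTop (𝓝 0))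
    (hratio : ∀ η : ℝ, 0 < η →
      (fun t : ℝ => Real.exp (η * t) * (mgf id F₂ t / mgf id F₁ t)) =O[atTop] μ)
    (f : ℝ → ℝ) (hf : ∀ s, 0 ≤ f s) (hf₀ : Tendsto f atTop (𝓝 0))
    (hφ₂ : ∀ᶠ s : ℝ in atTop, charFun F₂ s ≠ 0)
    (hφ : (fun s : ℝ => charFun F₁ s / charFun F₂ s) =O[atTop] f)
    -- the estimators of the slopes are in the regime where they are consistent
    (hα : Tendsto (fun n => MixRate.mgfVariance k T F₁ n) atTop (𝓝 0))
    (hβ : Tendsto (fun n => MixRate.betaRate k T F₂ f n) atTop (𝓝 0)) :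
    MixRate.IsBigOP P
        (fun n ω => MixRate.hatLambda K T x₀ x₁ n (fun p => X p ω) (fun p => Z p ω) L - (lam : ℂ))
        (MixRate.epsRate k T F₁ F₂ μ f) ∧
      (MemLp id 4 F₁ → MemLp id 4 F₂ →
        MixRate.IsBigOP P
            (fun n ω => MixRate.hatM K T x₀ x₁ n (fun p => X p ω) (fun p => Z p ω) L 0
              - (m₁ x₀ : ℂ))
            (MixRate.epsRate k T F₁ F₂ μ f) ∧
          MixRate.IsBigOP P
            (fun n ω => MixRate.hatM K T x₀ x₁ n (fun p => X p ω) (fun p => Z p ω) L 1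
              - (m₂ x₀ : ℂ))
            (MixRate.epsRate k T F₁ F₂ μ f)) := by
  have hl := hlam.1
  have hl' : 0 < 1 - lam := by linarith [hlam.2]
  obtain ⟨hα₀, hDelta⟩ := hsample.hatDelta_rate hlam hK hfX hfX_bdd hfX' hfX₀ hfX₁ hm₁ hm₁' hm₂ hm₂'
    T hh ht hth hmgf₁ hmgf₂ hμ hμ₀ hratio hα
  have hNabla := hsample.hatNabla_rate hlam hK hfX hfX_bdd hfX' hfX₀ hfX₁ hm₁ hm₂ hm₂' T hb hs hsb
    ha ha₀ hf hφ₂ hφ hβ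
  have hE := fun {x} (hx : 0 < fX x) => hsample.hatMoment_one_rate hlam hL hfX hfX_bdd hfX' hx hm₁
    hm₁' hm₂ hm₂' T hd hd₀ hmean₁ hmean₂ hvar₁ hvar₂
  set ε := MixRate.epsRate k T F₁ F₂ μ f with hεdef
  -- The delta method requires a vanishing rate.
  have hε : Tendsto ε atTop (𝓝 0) := by
    have := ((MixRate.tendsto_rpow_neg_two_div k).add hα₀).add hβ
    rw [add_zero, add_zero] at this
    exact this
  have hp : ∀ n : ℕ, 0 ≤ (n : ℝ) ^ (-(2 : ℝ) / (k + 4)) := fun n =>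
    Real.rpow_nonneg (Nat.cast_nonneg n) _
  have hαnn : ∀ᶠ n in atTop, 0 ≤ MixRate.alphaRate k T F₁ μ n := by
    filter_upwards [ht.eventually_gt_atTop 0] with n hn
    have := hμ (T.t n)
    unfold MixRate.alphaRate
    positivity
  have hβnn : ∀ n, 0 ≤ MixRate.betaRate k T F₂ f n := fun n => by
    have h1 := hf (T.s n)
    have h2 := hf (T.s n + T.a n)
    have h3 := MixRate.cfError_nonneg (k := k) T F₂ n (T.s n)
    have h4 := MixRate.cfError_nonneg (k := k) T F₂ n (T.s n + T.a n)
    unfold MixRate.betaRate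
    positivity
  have hDelta' := hDelta.mono_rate (r' := ε) (c := 1) hαnn (by
    filter_upwards [hαnn] with n hn
    have h1 := hp n
    have h2 := hβnn n
    simp only [hεdef, MixRate.epsRate]
    linarith)
  have hNabla' := hNabla.mono_rate (r' := ε) (c := 1) (Eventually.of_forall hβnn) (by
    filter_upwards [hαnn] with n hn
    have h1 := hp n
    have h2 := hβnn n
    simp only [hεdef, MixRate.epsRate]
    linarith)
  have hpε : ∀ᶠ n : ℕ in atTop, (n : ℝ) ^ (-(2 : ℝ) / (k + 4)) ≤ 1 * ε n := by
    filter_upwards [hαnn] with n hn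
    have h2 := hβnn n
    simp only [hεdef, MixRate.epsRate]
    linarith
  have hE' := fun {x} (hx : 0 < fX x) =>
    (hE hx).mono_rate (r' := ε) (c := 1) (Eventually.of_forall hp) hpε
  have hne : ((m₁ x₁ - m₁ x₀ : ℝ) : ℂ) - ((m₂ x₁ - m₂ x₀ : ℝ) : ℂ) ≠ 0 := by
    rw [← Complex.ofReal_sub]
    exact_mod_cast sub_ne_zero.2 hslope
  have hlc : (lam : ℂ) ≠ 0 := by exact_mod_cast hl.ne'
  have hlc' : (1 - (lam : ℂ)) ≠ 0 := by exact_mod_cast hl'.ne'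
  have eD : MixRate.EstimatesAt P ε
      (fun n ω => (MixRate.hatDelta K T x₀ x₁ n (fun p => X p ω) (fun p => Z p ω) : ℂ)) _ := hDelta'
  have eN : MixRate.EstimatesAt P ε
      (fun n ω => MixRate.hatNabla K T x₀ x₁ n (fun p => X p ω) (fun p => Z p ω)) _ := hNabla'
  have eE₀ : MixRate.EstimatesAt P ε
      (fun n ω => (MixRate.hatMoment T n (fun p => X p ω) (fun p => Z p ω) L 1 x₀ : ℂ)) _ :=
    hE' hfX₀
  have eE₁ : MixRate.EstimatesAt P ε
      (fun n ω => (MixRate.hatMoment T n (fun p => X p ω) (fun p => Z p ω) L 1 x₁ : ℂ)) _ :=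
    hE' hfX₁
  have eL : MixRate.EstimatesAt P ε (fun n ω => MixRate.hatLambda K T x₀ x₁ n (fun p => X p ω)
      (fun p => Z p ω) L) lam := by
    have h := ((eE₁.sub eE₀).sub eN).mul ((eD.sub eN).inv hε hne) hε
    -- At the limits the numerator is `λΔ + (1-λ)∇ - ∇ = λ(Δ - ∇)`.
    have hval : ((lam : ℂ) * m₁ x₁ + (1 - lam) * m₂ x₁ - (lam * m₁ x₀ + (1 - lam) * m₂ x₀) -
        (m₂ x₁ - m₂ x₀ : ℝ)) * ((m₁ x₁ - m₁ x₀ : ℝ) - (m₂ x₁ - m₂ x₀ : ℝ) : ℂ)⁻¹ = lam := by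
      rw [mul_inv_eq_iff_eq_mul₀ hne]
      push_cast
      ring
    rw [hval] at h
    exact h
  refine ⟨eL, fun hF₁ hF₂ => ?_⟩
  have hS := fun {x} (hx : 0 < fX x) => (hsample.hatMoment_two_rate hlam hL hfX hfX_bdd hfX' hx hm₁
    hm₁' hm₂ hm₂' T hd hd₀ hmean₁ hmean₂ hF₁ hF₂).mono_rate (r' := ε) (c := 1)
    (Eventually.of_forall hp) hpε
  have eS₀ : MixRate.EstimatesAt P ε
      (fun n ω => (MixRate.hatMoment T n (fun p => X p ω) (fun p => Z p ω) L 2 x₀ : ℂ)) _ :=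
    hS hfX₀
  have eS₁ : MixRate.EstimatesAt P ε
      (fun n ω => (MixRate.hatMoment T n (fun p => X p ω) (fun p => Z p ω) L 2 x₁ : ℂ)) _ :=
    hS hfX₁
  have eC : MixRate.EstimatesAt P ε (fun n ω => MixRate.hatC K T x₀ x₁ n (fun p => X p ω)
      (fun p => Z p ω) L) (-lam * m₁ x₀ * (m₁ x₁ - m₁ x₀ : ℝ) -
        (1 - lam) * m₂ x₀ * (m₂ x₁ - m₂ x₀ : ℝ)) := by
    -- With `m_l(x₁)² - m_l(x₀)² = 2 m_l(x₀)(m_l(x₁) - m_l(x₀)) + (m_l(x₁) - m_l(x₀))²` and the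
    -- variances cancelling, the added squares of the slopes leave only terms linear in `m_l(x₀)`.
    have h := (((eS₀.sub eS₁).add (eL.mul (eD.comp hε (g := fun z => z ^ 2) (by fun_prop)) hε)).add
      ((eL.comp hε (g := fun z => 1 - z) (by fun_prop)).mul
        (eN.comp hε (g := fun z => z ^ 2) (by fun_prop)) hε)).comp hε (g := fun z => 1 / 2 * z)
        (by fun_prop)
    refine MixRate.StochBdd.of_le h fun n ω => le_of_eq ?_
    beta_reduce
    rw [MixRate.hatC]
    congr 2
    push_cast
    ring
  have hne' : ((m₂ x₁ - m₂ x₀ : ℝ) : ℂ) - ((m₁ x₁ - m₁ x₀ : ℝ) : ℂ) ≠ 0 := by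
    rw [← neg_sub]; exact neg_ne_zero.2 hne
  constructor
  · have h := (eL.inv hε hlc).mul (((eN.sub eD).inv hε hne').mul (eC.add (eN.mul eE₀ hε)) hε) hε
    refine MixRate.StochBdd.of_le h fun n ω => le_of_eq ?_
    beta_reduce
    rw [MixRate.hatM_zero]
    congr 2
    -- The identity to check is `C + ∇ E(Z|x₀) = λ m₁(x₀) (∇ - Δ)`.
    rw [eq_inv_mul_iff_mul_eq₀ hlc, eq_inv_mul_iff_mul_eq₀ hne']
    push_cast
    ring
  · have h := ((eL.comp hε (g := fun z => 1 - z) (by fun_prop)).inv hε hlc').mul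
      (((eN.sub eD).inv hε hne').mul (eC.neg.sub (eD.mul eE₀ hε)) hε) hε
    refine MixRate.StochBdd.of_le h fun n ω => le_of_eq ?_
    beta_reduce
    rw [MixRate.hatM_one]
    congr 2
    -- Likewise `-C - Δ E(Z|x₀) = (1-λ) m₂(x₀) (∇ - Δ)`.
    rw [eq_inv_mul_iff_mul_eq₀ hlc', eq_inv_mul_iff_mul_eq₀ hne']
    push_cast
    ring
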